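/- Let $k$ be a positive integer. Let $\mathcal D_{\rm alg}(k)$ be the set of linear functionals $\mu:\mathbb C\langle X_1,\dots,X_k\rangle\to\mathbb C$ on the algebra of polynomials in $k$ non-commuting indeterminates with $\mu(1)=1$; these are the joint distributions $\mu_{x_1,\dots,x_k}$, $\mu_{x_1,\dots,x_k}(P)=\varphi(P(x_1,\dots,x_k))$, of $k$-tuples of elements of non-commutative probability spaces $(\mathcal A,\varphi)$ ($\mathcal A$ a unital complex algebra, $\varphi:\mathcal A\to\mathbb C$ linear, $\varphi(1)=1$). Let $\mathbb C_0\langle\langle z_1,\dots,z_k\rangle\rangle$ be the space of formal power series with zero constant term in $k$ non-commuting indeterminates. For $\mu\in\mathcal D_{\rm alg}(k)$ put $$M_\mu=\sum_{n\ge1}\ \sum_{i_1,\dots,i_n=1}^k\mu(X_{i_1}\cdots X_{i_n})\,z_{i_1}\cdots z_{i_n},\qquad \eta_\mu=M_\mu(1+M_\mu)^{-1},$$ and let $R_\mu$ be the unique series in $\mathbb C_0\langle\langle z_1,\dots,z_k\rangle\rangle$ with $R_\mu\bigl(z_1(1+M_\mu),\dots,z_k(1+M_\mu)\bigr)=M_\mu$.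 The maps $\mu\mapsto R_\mu$ and $\mu\mapsto\eta_\mu$ are bijections from $\mathcal D_{\rm alg}(k)$ onto $\mathbb C_0\langle\langle z_1,\dots,z_k\rangle\rangle$. For real $t>0$ let $\mu^{\boxplus t}$ and $\mu^{\uplus t}$ be the distributions determined by $R_{\mu^{\boxplus t}}=t\,R_\mu$ and $\eta_{\mu^{\uplus t}}=t\,\eta_\mu$, and for real $t\ge0$ let $$\mathbb B_t(\mu)=\bigl(\mu^{\boxplus(1+t)}\bigr)^{\uplus(1/(1+t))}.$$ Let $\boxtimes$ be the free multiplicative convolution: $\mu\boxtimes\nu$ is the joint distribution of $x_1y_1,\dots,x_ky_k$, where $x_1,\dots,x_k$ and $y_1,\dots,y_k$ are elements of a non-commutative probability space, with joint distributions $\mu$ and $\nu$ respectively, such that $\{x_1,\dots,x_k\}$ is freely independent from $\{y_1,\dots,y_k\}$. Then $\boxtimes$ is a well-defined binary operation on $\mathcal D_{\rm alg}(k)$ (for all $\mu,\nu$ such $x_i,y_i$ exist, and the joint distribution of the $x_iy_i$ depends only on $\mu$ and $\nu$), every $\mathbb B_t$ with $t\ge0$ is a bijection of $\mathcal D_{\rm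 alg}(k)$ onto itself, and: 1. $\mathbb B_s\circ\mathbb B_t=\mathbb B_{s+t}$ for all $s,t\ge0$. 2. $\mathbb B_1=\mathbb B$, the multi-variable Boolean Bercovici–Pata bijection, that is, the unique map $\mathbb B:\mathcal D_{\rm alg}(k)\to\mathcal D_{\rm alg}(k)$ with $R_{\mathbb B(\mu)}=\eta_\mu$ for all $\mu\in\mathcal D_{\rm alg}(k)$. 3. $\mathbb B_t(\mu\boxtimes\nu)=\mathbb B_t(\mu)\boxtimes\mathbb B_t(\nu)$ for all $t\ge0$ and $\mu,\nu\in\mathcal D_{\rm alg}(k)$. -/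

import Mathlib

universe u

/-- Formal power series in `k` non-commuting indeterminates with complex coefficients;
`f w` is the coefficient of the monomial `z_{i₁} ⋯ z_{iₙ}` for the word `w = [i₁, …, iₙ]`. -/
def NCSeries (k : ℕ) : Type := List (Fin k) → ℂ

namespace NCSeries

variable {k : ℕ}

instance : AddCommGroup (NCSeries k) := inferInstanceAs (AddCommGroup (List (Fin k) → ℂ))
noncomputable instance : Module ℂ (NCSeries k) := inferInstanceAs (Module ℂ (List (Fin k) → ℂ))

/-- The monomial `1`. -/
instance : One (NCSeries k) := ⟨fun w => if w = [] then 1 else 0⟩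

/-- Multiplication: the coefficient of a word is the sum over all its splittings in two. -/
noncomputable instance : Mul (NCSeries k) :=
  ⟨fun f g w => ∑ i ∈ Finset.range (w.length + 1), f (w.take i) * g (w.drop i)⟩

/-- The indeterminate `z_i`. -/
noncomputable def X (i : Fin k) : NCSeries k := fun w => if w = [i] then 1 else 0

@[ext] theorem ext {f g : NCSeries k} (h : ∀ w, f w = g w) : f = g := funext h

@[simp] theorem add_apply (f g : NCSeries k) (w) : (f + g) w = f w + g w := rfl
@[simp] theorem sub_apply (f g : NCSeries k) (w) : (f - g) w = f w - g w := rfl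
@[simp] theorem neg_apply (f : NCSeries k) (w) : (-f) w = -f w := rfl
@[simp] theorem zero_apply (w) : (0 : NCSeries k) w = 0 := rfl
@[simp] theorem smul_apply (c : ℂ) (f : NCSeries k) (w) : (c • f) w = c * f w := rfl
theorem one_apply (w) : (1 : NCSeries k) w = if w = [] then 1 else 0 := rfl
@[simp] theorem one_nil : (1 : NCSeries k) [] = 1 := by simp [one_apply]
@[simp] theorem one_cons (a) (w) : (1 : NCSeries k) (a :: w) = 0 := by simp [one_apply]

theorem mul_apply (f g : NCSeries k) (w) :
    (f * g) w = ∑ i ∈ Finset.range (w.length + 1), f (w.take i) * g (w.drop i) := rfl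

@[simp] theorem mul_nil (f g : NCSeries k) : (f * g) [] = f [] * g [] := by simp [mul_apply]

/-- Removal of a leading letter: the coefficient of `w` in `shift a f` is that of `a w` in `f`. -/
def shift (a : Fin k) (f : NCSeries k) : NCSeries k := fun w => f (a :: w)

@[simp] theorem shift_apply (a : Fin k) (f : NCSeries k) (w) : shift a f w = f (a :: w) := rfl

theorem mul_cons (f g : NCSeries k) (a) (w) :
    (f * g) (a :: w) = f [] * g (a :: w) + (shift a f * g) w := by
  simp only [mul_apply, List.length_cons]
  rw [Finset.sum_range_succ']
  simp [add_comm]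

protected theorem add_mul' (f g h : NCSeries k) : (f + g) * h = f * h + g * h := by
  ext w
  simp [mul_apply, add_mul, Finset.sum_add_distrib]

protected theorem mul_add' (f g h : NCSeries k) : f * (g + h) = f * g + f * h := by
  ext w
  simp [mul_apply, mul_add, Finset.sum_add_distrib]

protected theorem smul_mul' (c : ℂ) (f h : NCSeries k) : (c • f) * h = c • (f * h) := by
  ext w
  simp [mul_apply, Finset.mul_sum, mul_assoc]

theorem shift_mul (a : Fin k) (f g : NCSeries k) :
    shift a (f * g) = f [] • shift a g + shift a f * g := by
  ext w
  simp [mul_cons]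

protected theorem mul_assoc' (f g h : NCSeries k) : f * g * h = f * (g * h) := by
  ext w
  induction w generalizing f g h with
  | nil => simp [mul_assoc]
  | cons a w ih =>
    rw [mul_cons, shift_mul, NCSeries.add_mul', NCSeries.smul_mul', add_apply, smul_apply, ih,
      mul_cons f, mul_cons g, mul_nil]
    ring

protected theorem zero_mul' (f : NCSeries k) : 0 * f = 0 := by
  ext w
  simp [mul_apply]

protected theorem mul_zero' (f : NCSeries k) : f * 0 = 0 := by
  ext w
  simp [mul_apply]

protected theorem one_mul' (f : NCSeries k) : 1 * f = f := by
  ext w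
  cases w with
  | nil => simp
  | cons a w =>
    have : shift a (1 : NCSeries k) = 0 := by ext; simp
    simp [mul_cons, this, NCSeries.zero_mul']

protected theorem mul_one' (f : NCSeries k) : f * 1 = f := by
  ext w
  induction w generalizing f with
  | nil => simp
  | cons a w ih => simp [mul_cons, ih]

/-- The ring `ℂ⟨⟨z₁, …, z_k⟩⟩`. -/
noncomputable instance : Ring (NCSeries k) :=
  { (inferInstance : AddCommGroup (NCSeries k)) with
    mul := (· * ·)
    one := 1
    left_distrib := NCSeries.mul_add'
    right_distrib := NCSeries.add_mul'
    zero_mul := NCSeries.zero_mul'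
    mul_zero := NCSeries.mul_zero'
    mul_assoc := NCSeries.mul_assoc'
    one_mul := NCSeries.one_mul'
    mul_one := NCSeries.mul_one' }

/-- A self-map of the space of series for which each coefficient of the image depends only on
the coefficients of the argument at shorter words has exactly one fixed point. -/
theorem existsUnique_fixed (Φ : NCSeries k → NCSeries k)
    (h : ∀ f g w, (∀ v : List (Fin k), v.length < w.length → f v = g v) → Φ f w = Φ g w) :
    ∃! f, Φ f = f := by
  have hstep : ∀ n (w : List (Fin k)), w.length < n → Φ^[n] 0 w = Φ^[n + 1] 0 w := by
    intro n
    induction n with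
    | zero => intro w hw; simp at hw
    | succ n ih =>
      intro w hw
      rw [Function.iterate_succ_apply', Function.iterate_succ_apply' (n := n + 1)]
      exact h _ _ w fun v hv => ih v (by omega)
  have hst : ∀ (w : List (Fin k)) n, w.length + 1 ≤ n → Φ^[w.length + 1] 0 w = Φ^[n] 0 w := by
    intro w n hn
    induction n, hn using Nat.le_induction with
    | base => rfl
    | succ n hn ih => rw [ih]; exact hstep n w (by omega)
  refine ⟨fun w => Φ^[w.length + 1] 0 w, ?_, ?_⟩
  · ext w
    rw [Function.iterate_succ_apply']
    exact h _ _ w fun v hv => hst v _ (by omega)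
  · intro g hg
    ext w
    have key : ∀ n (w : List (Fin k)), w.length < n → g w = Φ^[n] 0 w := by
      intro n
      induction n with
      | zero => intro w hw; simp at hw
      | succ n ih =>
        intro w hw
        rw [Function.iterate_succ_apply', ← hg]
        conv_lhs => rw [hg]
        conv_lhs => rw [← hg]
        exact h _ _ w fun v hv => ih v (by omega)
    exact key _ w (by omega)

/-- A series with constant term `1` has a right inverse with constant term `1`. -/
theorem exists_rightInverse (f : NCSeries k) (hf : f [] = 1) :
    ∃ g : NCSeries k, g [] = 1 ∧ f * g = 1 := by
  obtain ⟨g, hg, -⟩ := existsUnique_fixed (k := k) (fun g => 1 - (f - 1) * g) (by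
    intro g g' w hw
    simp only [sub_apply, mul_apply]
    congr 1
    refine Finset.sum_congr rfl fun i _ => ?_
    rcases Nat.eq_zero_or_pos i with rfl | hi
    · simp [hf, one_apply]
    · cases w with
      | nil => simp [hf, one_apply]
      | cons a w => rw [hw _ (by simp; omega)])
  have hg' : 1 - (f - 1) * g = g := hg
  have h1 : f * g = 1 := by
    have h2 : f * g = 1 - (1 - (f - 1) * g) + g := by noncomm_ring
    rw [h2, hg', sub_add_cancel]
  refine ⟨g, ?_, h1⟩
  have := congrFun h1 []
  simpa [hf] using this

theorem isUnit_of_nil (f : NCSeries k) (hf : f [] = 1) : IsUnit f := by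
  obtain ⟨g, hg, hfg⟩ := exists_rightInverse f hf
  obtain ⟨h, -, hgh⟩ := exists_rightInverse g hg
  have : f = h := by
    calc f = f * (g * h) := by rw [hgh, mul_one]
      _ = h := by rw [← mul_assoc, hfg, one_mul]
  exact ⟨⟨f, g, hfg, by rw [this, hgh]⟩, rfl⟩

/-- Substitution `f(g₁, …, g_k)`, meant for series `g_i` without constant term: as a product of
`n` such series has no coefficients at words shorter than `n`, only the monomials of `f` of
degree at most `|w|` contribute to the coefficient of `w`. -/
noncomputable def subst (f : NCSeries k) (g : Fin k → NCSeries k) : NCSeries k := fun w =>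
  ∑ n ∈ Finset.range (w.length + 1), ∑ v : Fin n → Fin k,
    f (List.ofFn v) * (List.ofFn fun j => g (v j)).prod w

end NCSeries

/-- The space `ℂ₀⟨⟨z₁, …, z_k⟩⟩` of series with vanishing constant term. -/
noncomputable def NCSeries₀ (k : ℕ) : Submodule ℂ (NCSeries k) where
  carrier := {f | f [] = 0}
  add_mem' := by
    intro f g hf hg
    simp only [Set.mem_ofPred_eq] at *
    simp [hf, hg]
  zero_mem' := rfl
  smul_mem' := by
    intro c f hf
    simp only [Set.mem_ofPred_eq] at *
    simp [hf]

theorem NCSeries₀.nil {k : ℕ} (f : NCSeries₀ k) : (f : NCSeries k) [] = 0 := f.2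

namespace NCSeries

variable {k : ℕ}

theorem subst_X_mul_nil (f m : NCSeries k) : subst f (fun i => X i * m) [] = f [] := by
  simp [subst]

theorem X_mul_cons (i a : Fin k) (g : NCSeries k) (w) :
    (X i * g) (a :: w) = if a = i then g w else 0 := by
  rw [mul_cons]
  have h0 : X i ([] : List (Fin k)) = 0 := by simp [X]
  have h1 : shift a (X i) = if a = i then 1 else 0 := by
    ext v
    by_cases h : a = i <;> simp [X, h, one_apply]
  rw [h0, h1]
  by_cases h : a = i <;> simp [h]

theorem prod_eq_zero (m : NCSeries k) (n : ℕ) (v : Fin n → Fin k) (w : List (Fin k))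
    (h : w.length < n) : (List.ofFn fun j => X (v j) * m).prod w = 0 := by
  induction n generalizing w with
  | zero => simp at h
  | succ n ih =>
    rw [List.ofFn_succ, List.prod_cons, mul_assoc]
    cases w with
    | nil => simp [X]
    | cons a w =>
      rw [X_mul_cons]
      split_ifs with hi
      · rw [mul_apply]
        refine Finset.sum_eq_zero fun i _ => ?_
        rw [ih _ _ (by simp at h ⊢; omega), mul_zero]
      · rfl

theorem subst_eq_of_lt (f m : NCSeries k) (w : List (Fin k)) (N : ℕ) (hN : w.length < N) :
    subst f (fun i => X i * m) w = ∑ n ∈ Finset.range N, ∑ v : Fin n → Fin k,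
      f (List.ofFn v) * (List.ofFn fun j => X (v j) * m).prod w := by
  refine Finset.sum_subset (fun n hn => by simp at hn ⊢; omega) fun n _ hn => ?_
  refine Finset.sum_eq_zero fun v _ => ?_
  rw [prod_eq_zero m n v w (by simpa using hn), mul_zero]

theorem subst_X_mul_cons (f m : NCSeries k) (a) (w) :
    subst f (fun i => X i * m) (a :: w) = (m * subst (shift a f) (fun i => X i * m)) w := by
  rw [subst, mul_apply]
  have h1 : ∀ i ∈ Finset.range (w.length + 1),
      m (w.take i) * subst (shift a f) (fun i => X i * m) (w.drop i) =
      ∑ n ∈ Finset.range (w.length + 1), ∑ v : Fin n → Fin k,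
        f (a :: List.ofFn v) *
          (m (w.take i) * (List.ofFn fun j => X (v j) * m).prod (w.drop i)) := by
    intro i _
    rw [subst_eq_of_lt _ m _ (w.length + 1) (by simp), Finset.mul_sum]
    refine Finset.sum_congr rfl fun n _ => ?_
    rw [Finset.mul_sum]
    refine Finset.sum_congr rfl fun v _ => ?_
    rw [shift_apply]; ring
  rw [Finset.sum_congr rfl h1, Finset.sum_comm, List.length_cons, Finset.sum_range_succ']
  have h0 : ∑ v : Fin 0 → Fin k, f (List.ofFn v) *
      (List.ofFn fun j => X (v j) * m).prod (a :: w) = 0 := by simp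
  rw [h0, add_zero]
  refine Finset.sum_congr rfl fun n _ => ?_
  rw [Finset.sum_comm, ← (Fin.consEquiv fun _ => Fin k).sum_comp, Fintype.sum_prod_type,
    Finset.sum_eq_single a]
  · refine Finset.sum_congr rfl fun v _ => ?_
    rw [← Finset.mul_sum, ← mul_apply]
    simp [Fin.consEquiv, List.ofFn_succ, mul_assoc, X_mul_cons]
  · intro b _ hb
    refine Finset.sum_eq_zero fun v _ => ?_
    simp [Fin.consEquiv, List.ofFn_succ, mul_assoc, X_mul_cons, Ne.symm hb]
  · simp

theorem subst_sub (f f' : NCSeries k) (g : Fin k → NCSeries k) :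
    subst (f - f') g = subst f g - subst f' g := by
  ext w
  simp [subst, sub_mul, Finset.sum_sub_distrib]

theorem subst_top (m : NCSeries k) (hm : m [] = 1) (n : ℕ) :
    ∀ (f : NCSeries k) (w : List (Fin k)), w.length ≤ n →
      (∀ v : List (Fin k), v.length < w.length → f v = 0) →
      subst f (fun i => X i * m) w = f w := by
  induction n with
  | zero =>
    intro f w hw _
    rw [List.length_eq_zero_iff.mp (Nat.le_zero.mp hw), subst_X_mul_nil]
  | succ n ih =>
    intro f w hw hf
    cases w with
    | nil => rw [subst_X_mul_nil]
    | cons a w =>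
      simp only [List.length_cons] at hw hf
      rw [subst_X_mul_cons, mul_apply, Finset.sum_eq_single 0]
      · simp only [List.take_zero, hm, List.drop_zero, one_mul]
        exact ih (shift a f) w (by omega) fun v hv => hf _ (by simp; omega)
      · intro i hi hi0
        simp only [Finset.mem_range] at hi
        rw [ih (shift a f) (w.drop i) (by simp; omega)
          (fun v hv => hf _ (by simp at hv ⊢; omega)), shift_apply, hf _ (by simp; omega), mul_zero]
      · simp

theorem subst_congr_right (m m' : NCSeries k) (n : ℕ) :
    ∀ (f : NCSeries k) (w : List (Fin k)), w.length ≤ n →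
      (∀ v : List (Fin k), v.length < w.length → m v = m' v) →
      subst f (fun i => X i * m) w = subst f (fun i => X i * m') w := by
  induction n with
  | zero =>
    intro f w hw _
    rw [List.length_eq_zero_iff.mp (Nat.le_zero.mp hw), subst_X_mul_nil, subst_X_mul_nil]
  | succ n ih =>
    intro f w hw hm
    cases w with
    | nil => rw [subst_X_mul_nil, subst_X_mul_nil]
    | cons a w =>
      simp only [List.length_cons] at hw hm
      rw [subst_X_mul_cons, subst_X_mul_cons, mul_apply, mul_apply]
      refine Finset.sum_congr rfl fun i _ => ?_
      rw [hm _ (by simp), ih (shift a f) (w.drop i) (by simp; omega)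
        (fun v hv => hm v (by simp at hv; omega))]

/-- For `M` without constant term, `f(z₁(1+M), …, z_k(1+M)) = M` has a unique solution `f`. -/
theorem existsUnique_subst_eq (M : NCSeries₀ k) :
    ∃! f : NCSeries₀ k, subst (f : NCSeries k) (fun i => X i * (1 + M)) = M := by
  have hm : ((1 : NCSeries k) + M) [] = 1 := by simp [NCSeries₀.nil M]
  obtain ⟨f, hf, hu⟩ := existsUnique_fixed (k := k)
    (fun f => (M : NCSeries k) - (subst f (fun i => X i * (1 + M)) - f)) (by
      intro f g w hw
      have := subst_top _ hm w.length (f - g) w le_rfl (fun v hv => by simp [hw v hv])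
      rw [subst_sub] at this
      simp only [sub_apply] at this ⊢
      linear_combination -this)
  have hf' : subst f (fun i => X i * (1 + (M : NCSeries k))) = M := by
    ext w
    have := congrFun hf w
    simp only [sub_apply] at this
    linear_combination -this
  refine ⟨⟨f, ?_⟩, hf', ?_⟩
  · have := congrFun hf' []
    rw [subst_X_mul_nil, NCSeries₀.nil M] at this
    exact this
  · intro g hg
    refine Subtype.ext (hu _ ?_)
    ext w
    have := congrFun hg w
    simp only [sub_apply]
    rw [this]
    ring

/-- For `f` without constant term, `f(z₁(1+M), …, z_k(1+M)) = M` has a unique solution `M`. -/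
theorem existsUnique_eq_subst (f : NCSeries₀ k) :
    ∃! M : NCSeries₀ k, subst (f : NCSeries k) (fun i => X i * (1 + M)) = M := by
  obtain ⟨M, hM, hu⟩ := existsUnique_fixed (k := k)
    (fun M => subst (f : NCSeries k) (fun i => X i * (1 + M))) (by
      intro M M' w hw
      exact subst_congr_right _ _ w.length _ w le_rfl fun v hv => by simp [hw v hv])
  refine ⟨⟨M, ?_⟩, hM, fun M' hM' => Subtype.ext (hu _ hM')⟩
  have := congrFun hM []
  simp only [subst_X_mul_nil, NCSeries₀.nil f] at this
  exact this.symm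

end NCSeries

/-- The space `D_alg(k)` of linear functionals `μ` on `ℂ⟨X₁, …, X_k⟩` with `μ(1) = 1`. -/
abbrev Dalg (k : ℕ) : Type := {μ : FreeAlgebra ℂ (Fin k) →ₗ[ℂ] ℂ // μ 1 = 1}

/-- The joint distribution of `x₁, …, x_k` in a non-commutative probability space `(A, φ)`. -/
noncomputable def jointDist {k : ℕ} {A : Type u} [Ring A] [Algebra ℂ A] (φ : A →ₗ[ℂ] ℂ)
    (hφ : φ 1 = 1) (x : Fin k → A) : Dalg k :=
  ⟨φ ∘ₗ (FreeAlgebra.lift ℂ x).toLinearMap, by simp [hφ]⟩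

namespace Dalg

open NCSeries

variable {k : ℕ}

/-- The moment series `M_μ`. -/
noncomputable def momentSeries (μ : Dalg k) : NCSeries₀ k :=
  ⟨fun w => if w = [] then 0 else μ.1 (w.map (FreeAlgebra.ι ℂ)).prod, if_pos rfl⟩

theorem momentSeries_bijective : Function.Bijective (momentSeries (k := k)) := by
  have hb : ∀ w : FreeMonoid (Fin k), FreeAlgebra.basisFreeMonoid ℂ (Fin k) w =
      (w.toList.map (FreeAlgebra.ι ℂ)).prod := by
    intro w
    simp [FreeAlgebra.basisFreeMonoid, FreeAlgebra.equivMonoidAlgebraFreeMonoid,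
      FreeMonoid.lift_apply]
  constructor
  · intro μ ν h
    refine Subtype.ext ((FreeAlgebra.basisFreeMonoid ℂ (Fin k)).ext fun w => ?_)
    rw [hb]
    have h' := congrFun (congrArg Subtype.val h) w.toList
    simp only [momentSeries] at h'
    by_cases hw : w.toList = []
    · simp [hw, μ.2, ν.2]
    · simpa [hw] using h'
  · intro f
    have hval : ∀ w : List (Fin k), ((FreeAlgebra.basisFreeMonoid ℂ (Fin k)).constr ℂ
        fun w => ((1 : NCSeries k) + f) w.toList) (w.map (FreeAlgebra.ι ℂ)).prod =
        ((1 : NCSeries k) + f) w := by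
      intro w
      have := (FreeAlgebra.basisFreeMonoid ℂ (Fin k)).constr_basis ℂ
        (fun w => ((1 : NCSeries k) + f) w.toList) (FreeMonoid.ofList w)
      rw [hb] at this
      simpa using this
    refine ⟨⟨(FreeAlgebra.basisFreeMonoid ℂ (Fin k)).constr ℂ
      fun w => ((1 : NCSeries k) + f) w.toList, ?_⟩, ?_⟩
    · have := hval []
      rw [List.map_nil, List.prod_nil] at this
      rw [this]
      simp [NCSeries₀.nil f]
    · refine Subtype.ext (NCSeries.ext fun w => ?_)
      by_cases hw : w = []
      · simp [momentSeries, hw, NCSeries₀.nil f]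
      · simp only [momentSeries, hw, if_false]
        rw [hval w]
        simp [one_apply, hw]

theorem one_add_nil (f : NCSeries₀ k) : (1 + f : NCSeries k) [] = 1 := by simp [NCSeries₀.nil f]

/-- The `η`-series `η_μ = M_μ (1 + M_μ)⁻¹`; here `1 + M_μ` is invertible, having constant
term `1`. -/
noncomputable def etaSeries (μ : Dalg k) : NCSeries₀ k :=
  ⟨momentSeries μ * Ring.inverse (1 + momentSeries μ : NCSeries k), by
    change ((momentSeries μ : NCSeries k) * _) [] = 0
    rw [mul_nil, NCSeries₀.nil (momentSeries μ), zero_mul]⟩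

theorem etaSeries_bijective : Function.Bijective (etaSeries (k := k)) := by
  have hkey : ∀ μ : Dalg k, (1 - etaSeries μ : NCSeries k) * (1 + momentSeries μ) = 1 := by
    intro μ
    have hu := isUnit_of_nil _ (one_add_nil (momentSeries μ))
    rw [sub_mul, etaSeries, mul_assoc, Ring.inverse_mul_cancel _ hu]
    simp
  constructor
  · intro μ ν h
    refine momentSeries_bijective.1 (Subtype.ext ?_)
    have h1 := hkey μ
    rw [h] at h1
    replace h1 := h1.trans (hkey ν).symm
    have hu : IsUnit (1 - etaSeries ν : NCSeries k) := isUnit_of_nil _ (by simp [NCSeries₀.nil (etaSeries ν)])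
    exact add_left_cancel (hu.mul_left_cancel h1)
  · intro f
    have hu : IsUnit (1 - f : NCSeries k) := isUnit_of_nil _ (by simp [NCSeries₀.nil f])
    obtain ⟨g, hg, hfg⟩ := exists_rightInverse (1 - f : NCSeries k) (by simp [NCSeries₀.nil f])
    obtain ⟨μ, hμ⟩ := momentSeries_bijective.2 (⟨g - 1, by
      change (g - 1) [] = 0
      simp [hg]⟩ : NCSeries₀ k)
    refine ⟨μ, Subtype.ext ?_⟩
    have h1 := hkey μ
    have h2 : (1 + momentSeries μ : NCSeries k) = g := by rw [hμ]; simp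
    have hug : IsUnit g := isUnit_of_nil _ hg
    rw [h2] at h1
    exact sub_right_injective (hug.mul_right_cancel (h1.trans hfg.symm))

/-- The `R`-transform `R_μ`: the unique series without constant term such that
`R_μ(z₁(1 + M_μ), …, z_k(1 + M_μ)) = M_μ`. -/
noncomputable def rTransform (μ : Dalg k) : NCSeries₀ k :=
  (existsUnique_subst_eq (momentSeries μ)).choose

theorem rTransform_spec (μ : Dalg k) :
    subst (rTransform μ : NCSeries k) (fun i => X i * (1 + momentSeries μ)) = momentSeries μ :=
  (existsUnique_subst_eq (momentSeries μ)).choose_spec.1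

theorem rTransform_bijective : Function.Bijective (rTransform (k := k)) := by
  constructor
  · intro μ ν h
    have h1 := rTransform_spec μ
    rw [h] at h1
    exact momentSeries_bijective.1
      ((existsUnique_eq_subst (rTransform ν)).unique h1 (rTransform_spec ν))
  · intro f
    obtain ⟨M, hM, -⟩ := existsUnique_eq_subst f
    obtain ⟨μ, rfl⟩ := momentSeries_bijective.2 M
    exact ⟨μ, (existsUnique_subst_eq (momentSeries μ)).unique (rTransform_spec μ) hM⟩

/-- The bijection `μ ↦ R_μ`. -/
noncomputable def rEquiv (k : ℕ) : Dalg k ≃ NCSeries₀ k := Equiv.ofBijective _ rTransform_bijective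

/-- The bijection `μ ↦ η_μ`. -/
noncomputable def etaEquiv (k : ℕ) : Dalg k ≃ NCSeries₀ k := Equiv.ofBijective _ etaSeries_bijective

/-- The convolution power `μ^{⊞ t}`: the unique distribution with `R`-transform `t R_μ`. -/
noncomputable def boxplusPow (μ : Dalg k) (t : ℝ) : Dalg k :=
  (rEquiv k).symm ((t : ℂ) • rTransform μ)

/-- The convolution power `μ^{⊎ t}`: the unique distribution with `η`-series `t η_μ`. -/
noncomputable def uplusPow (μ : Dalg k) (t : ℝ) : Dalg k :=
  (etaEquiv k).symm ((t : ℂ) • etaSeries μ)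

/-- The transformation `𝔹_t(μ) = (μ^{⊞(1+t)})^{⊎(1/(1+t))}`, used for `t ≥ 0`. -/
noncomputable def BB (t : ℝ) (μ : Dalg k) : Dalg k := (μ.boxplusPow (1 + t)).uplusPow (1 / (1 + t))

/-- The multi-variable Boolean Bercovici–Pata bijection: `𝔹(μ)` is the unique distribution
whose `R`-transform is `η_μ`. -/
noncomputable def booleanBercoviciPata (μ : Dalg k) : Dalg k := (rEquiv k).symm (etaSeries μ)

end Dalg

/-- Free independence of a family of unital subalgebras `B i` with respect to `φ`:
`φ(a₁ ⋯ aₙ) = 0` whenever `n ≥ 1`, `a_j ∈ B (i_j)`, `φ(a_j) = 0` and `i₁ ≠ i₂ ≠ ⋯ ≠ iₙ`. -/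
def FreelyIndependent {A : Type u} [Ring A] [Algebra ℂ A] (φ : A →ₗ[ℂ] ℂ) {ι : Type}
    (B : ι → Subalgebra ℂ A) : Prop :=
  ∀ l : List (ι × A), l ≠ [] → l.IsChain (fun p q => p.1 ≠ q.1) →
    (∀ p ∈ l, p.2 ∈ B p.1 ∧ φ p.2 = 0) → φ (l.map Prod.snd).prod = 0

/-- `ρ` is the joint distribution of `x₁ y₁, …, x_k y_k` for some `k`-tuples `x` and `y`, with
joint distributions `μ` and `ν`, in some non-commutative probability space `(A, φ)` in which
`{x₁, …, x_k}` is freely independent from `{y₁, …, y_k}`. -/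
def IsFreeMulConv {k : ℕ} (μ ν ρ : Dalg k) : Prop :=
  ∃ (A : Type u) (_ : Ring A) (_ : Algebra ℂ A) (φ : A →ₗ[ℂ] ℂ) (hφ : φ 1 = 1) (x y : Fin k → A),
    jointDist φ hφ x = μ ∧ jointDist φ hφ y = ν ∧
    FreelyIndependent φ (fun b : Bool =>
      if b then Algebra.adjoin ℂ (Set.range x) else Algebra.adjoin ℂ (Set.range y)) ∧
    jointDist φ hφ (fun i => x i * y i) = ρ

open Classical in
/-- The free multiplicative convolution `μ ⊠ ν`: the distribution `ρ` with
`IsFreeMulConv μ ν ρ`. (There is exactly one such `ρ`, so the default value `μ` never matters; this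
is not assumed, but stated as `IsFreeMulConv μ ν ρ ↔ ρ = freeMulConv μ ν` where `⊠` is used.) -/
noncomputable def freeMulConv {k : ℕ} (μ ν : Dalg k) : Dalg k :=
  if h : ∃ ρ, IsFreeMulConv.{0} μ ν ρ then h.choose else μ

/-!
The proof works with `η`-series and avoids non-crossing partitions; three facts carry it.

*The flow.* For series `f`, `h` without constant term let `FlowRel t f h` be the equation
`f(z_i (1 - t h)⁻¹) = h (1 - t h)⁻¹`. It defines `h` uniquely in terms of `f`, and substitution
shows that the parameters add up under composition (`FlowRel.trans`). The definitions of `R_μ` and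
`η_μ` say that time `1` takes `R_μ` to `η_μ`, and together with the scaling rule
`FlowRel.of_smul` this shows that time `t` takes `η_μ` to the `η`-series of `𝔹_t(μ)`
(`Dalg.flowRel_etaSeries_BB`). Hence `𝔹_s ∘ 𝔹_t = 𝔹_{s+t}`, each `𝔹_t` is bijective, and
`R_{𝔹_1(μ)} = η_μ`, both sides being the image of `η_{𝔹_1(μ)}` at time `-1`.

*Boxed convolution.* The boxed convolution of `f` and `g` is `h = ∑ F_a G_a`, where `F` and `G`
solve the system `F_u = f^{(u)}(z_1 G_1, …, z_k G_k) z_u`, `G_a = ^{(a)}g(F_1, …, F_k)`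
(`IsBoxSystem`), in which `f^{(u)}` and `^{(a)}g` arise by removal of a final and of a leading
letter. Uniqueness of the solutions of such systems shows that the flow is multiplicative for
boxed convolution (`FlowRel.box`).

*Freeness.* If `x` is free from `y`, then the `η`-series of `x_1 y_1, …, x_k y_k` is the boxed
convolution of the two `η`-series. This is read off from a factorization of the resolvent of
`∑ z_a x_a y_a` into centred factors (`FreelyIndependent.moment_series_mul`). In particular the
joint distribution of the products depends on the two marginals only, and multiplicativity of
`𝔹_t` follows from that of the flow. Free realizations with given `η`-series exist on a Fock
space whose basis are the words in letters of two colours (`Dalg.exists_isFreeMulConv`).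
-/

/-! ### Substitution of series -/

namespace NCSeries

variable {k : ℕ}

noncomputable instance : Algebra ℂ (NCSeries k) :=
  Algebra.ofModule NCSeries.smul_mul' fun c f g => by
    ext w
    simp only [smul_apply, mul_apply, Finset.mul_sum]
    exact Finset.sum_congr rfl fun i _ => by ring

theorem sum_apply {ι : Type*} (s : Finset ι) (f : ι → NCSeries k) (w : List (Fin k)) :
    (∑ i ∈ s, f i) w = ∑ i ∈ s, f i w := by
  classical
  induction s using Finset.induction_on with
  | empty => simp
  | insert a s ha ih => rw [Finset.sum_insert ha, Finset.sum_insert ha, add_apply, ih]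

@[simp] theorem X_nil (a : Fin k) : X a ([] : List (Fin k)) = 0 := by simp [X]

@[simp] theorem shift_X_mul (i a : Fin k) (g : NCSeries k) :
    shift a (X i * g) = if a = i then g else 0 := by
  ext w
  rw [shift_apply, X_mul_cons]
  split_ifs <;> rfl

theorem shift_sum {ι : Type*} (s : Finset ι) (f : ι → NCSeries k) (a : Fin k) :
    shift a (∑ i ∈ s, f i) = ∑ i ∈ s, shift a (f i) := by
  ext w
  simp [sum_apply]

/-- Removal of a final letter: the coefficient of `w` in `rshift a f` is that of `w a` in `f`. -/
def rshift (a : Fin k) (f : NCSeries k) : NCSeries k := fun w => f (w ++ [a])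

@[simp] theorem rshift_apply (a : Fin k) (f : NCSeries k) (w) : rshift a f w = f (w ++ [a]) := rfl

theorem rshift_sum {ι : Type*} (s : Finset ι) (f : ι → NCSeries k) (a : Fin k) :
    rshift a (∑ i ∈ s, f i) = ∑ i ∈ s, rshift a (f i) := by
  ext w
  simp [sum_apply]

theorem rshift_mul (a : Fin k) (f g : NCSeries k) :
    rshift a (f * g) = f * rshift a g + g [] • rshift a f := by
  ext w
  rw [rshift_apply, mul_apply, List.length_append, List.length_singleton, Finset.sum_range_succ,
    add_apply, mul_apply, smul_apply, rshift_apply]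
  congr 1
  · refine Finset.sum_congr rfl fun i hi => ?_
    have hi' : i ≤ w.length := by simpa [Nat.lt_succ_iff] using hi
    rw [List.take_append_of_le_length hi', List.drop_append_of_le_length hi', rshift_apply]
  · rw [List.take_of_length_le (by simp), List.drop_of_length_le (by simp), mul_comm]

@[simp] theorem rshift_mul_X (i a : Fin k) (g : NCSeries k) :
    rshift a (g * X i) = if a = i then g else 0 := by
  have h : rshift a (X i) = if a = i then 1 else 0 := by
    ext v
    cases v <;> by_cases h : a = i <;> simp [X, h]
  rw [rshift_mul, h]
  split_ifs <;> simp

theorem eq_sum_X_mul (f : NCSeries k) : f = f [] • 1 + ∑ a, X a * shift a f := by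
  ext w
  cases w with
  | nil => simp [sum_apply]
  | cons a w => simp [sum_apply, X_mul_cons]

theorem eq_sum_mul_X (f : NCSeries k) : f = f [] • 1 + ∑ a, rshift a f * X a := by
  ext w
  induction w using List.reverseRecOn with
  | nil => simp [sum_apply]
  | append_singleton w a _ =>
    change _ = rshift a _ w
    have h : rshift a (f [] • 1 + ∑ b, rshift b f * X b) =
        f [] • rshift a 1 + ∑ b, rshift a (rshift b f * X b) := by
      rw [← rshift_sum]; rfl
    have h1 : rshift a (1 : NCSeries k) = 0 := by
      ext v
      simp [one_apply]
    rw [h, h1]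
    simp

/-- A right inverse of a series with constant term `1` is also a left inverse. -/
theorem mul_eq_one_comm_of_nil {f g : NCSeries k} (hf : f [] = 1) (h : f * g = 1) : g * f = 1 := by
  have hu := isUnit_of_nil f hf
  exact hu.mul_left_cancel (by rw [← mul_assoc, h, one_mul, mul_one])

/-- The two series have the same coefficients at words shorter than `N`. -/
def AgreeBelow (N : ℕ) (f g : NCSeries k) : Prop := ∀ w : List (Fin k), w.length < N → f w = g w

namespace AgreeBelow

variable {N : ℕ} {f f' g g' : NCSeries k}

theorem refl (f : NCSeries k) : AgreeBelow N f f := fun _ _ => rfl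

theorem symm (h : AgreeBelow N f g) : AgreeBelow N g f := fun w hw => (h w hw).symm

theorem trans {e : NCSeries k} (h : AgreeBelow N f g) (h' : AgreeBelow N g e) :
    AgreeBelow N f e := fun w hw => (h w hw).trans (h' w hw)

theorem mono {M : ℕ} (hM : M ≤ N) (h : AgreeBelow N f g) : AgreeBelow M f g :=
  fun w hw => h w (by omega)

theorem add (h : AgreeBelow N f f') (h' : AgreeBelow N g g') : AgreeBelow N (f + g) (f' + g') :=
  fun w hw => by rw [add_apply, add_apply, h w hw, h' w hw]

theorem sum {ι : Type*} {s : Finset ι} {f g : ι → NCSeries k}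
    (h : ∀ i ∈ s, AgreeBelow N (f i) (g i)) : AgreeBelow N (∑ i ∈ s, f i) (∑ i ∈ s, g i) :=
  fun w hw => by rw [sum_apply, sum_apply]; exact Finset.sum_congr rfl fun i hi => h i hi w hw

theorem mul (h : AgreeBelow N f f') (h' : AgreeBelow N g g') : AgreeBelow N (f * g) (f' * g') := by
  intro w hw
  rw [mul_apply, mul_apply]
  refine Finset.sum_congr rfl fun i _ => ?_
  rw [h _ (by simp; omega), h' _ (by simp; omega)]

/-- Multiplication by a series without constant term gains one degree of agreement. -/
theorem mul_succ (hf : f [] = 0) (h : AgreeBelow N g g') :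
    AgreeBelow (N + 1) (f * g) (f * g') := by
  intro w hw
  rw [mul_apply, mul_apply]
  refine Finset.sum_congr rfl fun i _ => ?_
  rcases Nat.eq_zero_or_pos i with rfl | hi
  · simp [hf]
  · rcases w with _ | ⟨a, w⟩
    · simp [hf]
    · rw [h _ (by simp at hw ⊢; omega)]

theorem mul_X (h : AgreeBelow N g g') (a : Fin k) :
    AgreeBelow (N + 1) (g * X a) (g' * X a) := by
  intro w hw
  rw [mul_apply, mul_apply]
  refine Finset.sum_congr rfl fun i hi => ?_
  have hi' : i ≤ w.length := by simpa [Nat.lt_succ_iff] using hi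
  rcases hi'.eq_or_lt with rfl | hi'
  · simp
  · rw [h _ (by simp; omega)]

end AgreeBelow

theorem eq_of_agreeBelow {f g : NCSeries k} (h : ∀ N, AgreeBelow N f g) : f = g :=
  NCSeries.ext fun w => h (w.length + 1) w (Nat.lt_succ_self _)

theorem list_prod_apply_eq_zero (l : List (NCSeries k)) (hl : ∀ f ∈ l, f [] = 0)
    (w : List (Fin k)) (hw : w.length < l.length) : l.prod w = 0 := by
  induction l generalizing w with
  | nil => simp at hw
  | cons f l ih =>
    have h : AgreeBelow l.length l.prod 0 :=
      fun v hv => ih (fun g hg => hl g (List.mem_cons_of_mem _ hg)) v hv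
    have := h.mul_succ (hl f List.mem_cons_self) w (by simpa using hw)
    simpa using this

/-- The part of `subst f s` coming from the monomials of `f` of degree less than `N`. -/
noncomputable def substTrunc (f : NCSeries k) (s : Fin k → NCSeries k) (N : ℕ) : NCSeries k :=
  ∑ n ∈ Finset.range N, ∑ v : Fin n → Fin k,
    f (List.ofFn v) • (List.ofFn fun j => s (v j)).prod

theorem substTrunc_succ (f : NCSeries k) (s : Fin k → NCSeries k) (N : ℕ) :
    substTrunc f s (N + 1) = f [] • 1 + ∑ a, s a * substTrunc (shift a f) s N := by
  have h0 : ∑ v : Fin 0 → Fin k, f (List.ofFn v) • (List.ofFn fun j => s (v j)).prod =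
      f [] • 1 := by simp
  rw [substTrunc, Finset.sum_range_succ', h0, add_comm]
  congr 1
  simp only [substTrunc, Finset.mul_sum]
  rw [Finset.sum_comm]
  refine Finset.sum_congr rfl fun n _ => ?_
  rw [← (Fin.consEquiv fun _ => Fin k).sum_comp, Fintype.sum_prod_type]
  refine Finset.sum_congr rfl fun a _ => Finset.sum_congr rfl fun v _ => ?_
  simp [Fin.consEquiv, List.ofFn_succ]

theorem agreeBelow_subst_substTrunc (f : NCSeries k) {s : Fin k → NCSeries k}
    (hs : ∀ a, s a [] = 0) (N : ℕ) : AgreeBelow N (subst f s) (substTrunc f s N) := by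
  intro w hw
  simp only [subst, substTrunc, sum_apply, smul_apply]
  refine Finset.sum_subset (fun n hn => by simp at hn ⊢; omega) fun n _ hn => ?_
  refine Finset.sum_eq_zero fun v _ => ?_
  rw [list_prod_apply_eq_zero, mul_zero]
  · intro g hg
    obtain ⟨j, rfl⟩ := List.mem_ofFn.mp hg
    exact hs _
  · simpa using hn

/-- The recursion on the leading letter that characterizes substitution. -/
theorem subst_eq (f : NCSeries k) {s : Fin k → NCSeries k} (hs : ∀ a, s a [] = 0) :
    subst f s = f [] • 1 + ∑ a, s a * subst (shift a f) s := by
  refine eq_of_agreeBelow fun N => ((agreeBelow_subst_substTrunc f hs (N + 1)).mono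
    (Nat.le_succ N)).trans ?_
  rw [substTrunc_succ]
  exact (AgreeBelow.refl _).add (AgreeBelow.sum fun a _ =>
    (AgreeBelow.refl _).mul (agreeBelow_subst_substTrunc _ hs N).symm)

/-- A family of series indexed by series which satisfies the same recursion as
substitution is substitution. -/
theorem eq_subst_of_rec {ι : Type*} (Ψ : ι → NCSeries k) (p : ι → NCSeries k)
    (d : Fin k → ι → ι) (hd : ∀ a i, p (d a i) = shift a (p i)) {s : Fin k → NCSeries k}
    (hs : ∀ a, s a [] = 0) (h : ∀ i, Ψ i = p i [] • 1 + ∑ a, s a * Ψ (d a i)) (i : ι) :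
    Ψ i = subst (p i) s := by
  refine eq_of_agreeBelow fun N => ?_
  induction N generalizing i with
  | zero => intro w hw; simp at hw
  | succ N ih =>
    rw [h, subst_eq _ hs]
    refine (AgreeBelow.refl _).add (AgreeBelow.sum fun a _ => ?_)
    rw [← hd]
    exact (ih _).mul_succ (hs a)

theorem subst_nil (f : NCSeries k) (s : Fin k → NCSeries k) : subst f s [] = f [] := by
  simp [subst]

theorem subst_add (f g : NCSeries k) (s : Fin k → NCSeries k) :
    subst (f + g) s = subst f s + subst g s := by
  ext w
  simp [subst, add_mul, Finset.sum_add_distrib]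

theorem subst_smul (c : ℂ) (f : NCSeries k) (s : Fin k → NCSeries k) :
    subst (c • f) s = c • subst f s := by
  ext w
  simp [subst, Finset.mul_sum, mul_assoc]

theorem subst_zero (s : Fin k → NCSeries k) : subst 0 s = 0 := by
  simpa using subst_smul 0 0 s

theorem subst_sum {ι : Type*} (t : Finset ι) (f : ι → NCSeries k)
    (s : Fin k → NCSeries k) :
    subst (∑ i ∈ t, f i) s = ∑ i ∈ t, subst (f i) s := by
  classical
  induction t using Finset.induction_on with
  | empty => simp [subst_zero]
  | insert a t ha ih => rw [Finset.sum_insert ha, Finset.sum_insert ha, subst_add, ih]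

section

variable {s : Fin k → NCSeries k} (hs : ∀ a, s a [] = 0)
include hs

theorem subst_one : subst 1 s = 1 := by
  have h : ∀ a, shift a (1 : NCSeries k) = 0 := fun a => by ext; simp
  rw [subst_eq _ hs]
  simp [h, subst_zero]

theorem subst_X (i : Fin k) : subst (X i) s = s i := by
  have h : ∀ a, shift a (X i) = if a = i then 1 else 0 := fun a => by
    simpa using shift_X_mul i a 1
  rw [subst_eq _ hs, Finset.sum_eq_single i]
  · simp [h, subst_one hs]
  · intro a _ ha
    simp [h, ha, subst_zero]
  · simp

theorem subst_mul (f g : NCSeries k) : subst (f * g) s = subst f s * subst g s := by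
  refine eq_of_agreeBelow fun N => ?_
  induction N generalizing f with
  | zero => intro w hw; simp at hw
  | succ N ih =>
    have h1 : subst (f * g) s = f [] • subst g s + ∑ a, s a * subst (shift a f * g) s := by
      conv_lhs => rw [subst_eq _ hs]
      conv_rhs => rw [subst_eq g hs]
      simp only [shift_mul, subst_add, subst_smul, mul_add, Finset.sum_add_distrib, mul_nil,
        smul_add, Finset.smul_sum, mul_smul_comm, smul_smul, add_assoc]
    have h2 : subst f s * subst g s =
        f [] • subst g s + ∑ a, s a * (subst (shift a f) s * subst g s) := by
      rw [subst_eq f hs, add_mul, Finset.sum_mul, smul_mul_assoc, one_mul]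
      simp only [mul_assoc]
    rw [h1, h2]
    exact (AgreeBelow.refl _).add (AgreeBelow.sum fun a _ => (ih _).mul_succ (hs a))

/-- The recursion on the final letter. -/
theorem subst_eq_right (f : NCSeries k) :
    subst f s = f [] • 1 + ∑ a, subst (rshift a f) s * s a := by
  conv_lhs => rw [eq_sum_mul_X f]
  rw [subst_add, subst_smul, subst_one hs, subst_sum]
  simp only [subst_mul hs, subst_X hs]

theorem subst_subst (f : NCSeries k) {r : Fin k → NCSeries k} (hr : ∀ a, r a [] = 0) :
    subst (subst f r) s = subst f (fun a => subst (r a) s) := by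
  have hrs : ∀ a, subst (r a) s [] = 0 := fun a => by rw [subst_nil, hr]
  refine eq_subst_of_rec (fun f => subst (subst f r) s) id shift (fun _ _ => rfl) hrs
    (fun f => ?_) f
  simp only [id]
  conv_lhs => rw [subst_eq f hr]
  rw [subst_add, subst_smul, subst_one hs, subst_sum]
  simp only [subst_mul hs]

end

theorem subst_id (f : NCSeries k) : subst f X = f :=
  (eq_subst_of_rec id id shift (fun _ _ => rfl) X_nil eq_sum_X_mul f).symm

theorem AgreeBelow.subst {N : ℕ} (f : NCSeries k) {s s' : Fin k → NCSeries k}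
    (hs : ∀ a, s a [] = 0) (hs' : ∀ a, s' a [] = 0) (h : ∀ a, AgreeBelow N (s a) (s' a)) :
    AgreeBelow N (subst f s) (subst f s') := by
  have key : ∀ M, M ≤ N → ∀ f, AgreeBelow M (NCSeries.subst f s) (NCSeries.subst f s') := by
    intro M
    induction M with
    | zero => intro _ f w hw; simp at hw
    | succ M ih =>
      intro hM f
      rw [subst_eq f hs, subst_eq f hs']
      refine (AgreeBelow.refl _).add (AgreeBelow.sum fun a _ => ?_)
      exact ((ih (by omega) _).mul_succ (hs a)).trans (((h a).mono hM).mul (AgreeBelow.refl _))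
  exact key N le_rfl f

end NCSeries

/-! ### The flow interpolating between the `R`-transform and the `η`-series -/

namespace NCSeries

variable {k : ℕ}

/-- `f` and `h` are series without constant term such that
`f(z₁(1 - t h)⁻¹, …, z_k(1 - t h)⁻¹) = h (1 - t h)⁻¹`; the series `n` is `(1 - t h)⁻¹`. -/
def FlowRel (t : ℂ) (f h : NCSeries k) : Prop :=
  f [] = 0 ∧ h [] = 0 ∧ ∃ n : NCSeries k, (1 - t • h) * n = 1 ∧
    subst f (fun i => X i * n) = h * n

theorem nil_of_mul_eq_one {t : ℂ} {h n : NCSeries k} (hh : h [] = 0)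
    (hn : (1 - t • h) * n = 1) : n [] = 1 := by
  simpa [hh] using congrFun hn []

theorem X_mul_nil (m : Fin k → NCSeries k) (a : Fin k) : (X a * m a) [] = 0 := by simp

theorem subst_congr {f : NCSeries k} {s s' : Fin k → NCSeries k} (h : ∀ a, s a = s' a) :
    subst f s = subst f s' := by rw [funext h]

theorem subst_sub_one_smul {s : Fin k → NCSeries k} (hs : ∀ a, s a [] = 0) (t : ℂ)
    (h : NCSeries k) : subst (1 - t • h) s = 1 - t • subst h s := by
  rw [subst_sub, subst_one hs, subst_smul]

/-- The flow property: parameters add up under composition. -/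
theorem FlowRel.trans {s t : ℂ} {f g h : NCSeries k} (h₁ : FlowRel s f g) (h₂ : FlowRel t g h) :
    FlowRel (s + t) f h := by
  obtain ⟨hf, hg, n, hn, hfn⟩ := h₁
  obtain ⟨-, hh, m, hm, hgm⟩ := h₂
  have hX : ∀ a, (X a * m : NCSeries k) [] = 0 := X_mul_nil fun _ => m
  set σ : NCSeries k → NCSeries k := fun e => subst e fun i => X i * m with hσ
  have h1 : (1 - s • (h * m)) * σ n = 1 := by
    have := congrArg σ hn
    simp only [hσ] at this
    rwa [subst_mul hX, subst_sub_one_smul hX, subst_one hX, hgm] at this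
  refine ⟨hf, hh, m * σ n, ?_, ?_⟩
  · have h2 : (1 - (s + t) • h) * m = 1 - s • (h * m) := by
      conv_rhs => rw [← hm]
      simp only [add_smul, sub_mul, add_mul, one_mul, smul_mul_assoc]
      abel
    rw [← mul_assoc, h2, h1]
  · have h3 : subst (subst f fun i => X i * n) (fun i => X i * m) = h * m * σ n := by
      rw [hfn, subst_mul hX, hgm]
    rw [subst_subst hX _ (X_mul_nil fun _ => n)] at h3
    rw [← mul_assoc, ← h3]
    refine subst_congr fun a => ?_
    rw [subst_mul hX, subst_X hX, mul_assoc]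

theorem FlowRel.eq_of_zero {f h : NCSeries k} (hfh : FlowRel 0 f h) : f = h := by
  obtain ⟨-, -, n, hn, hfn⟩ := hfh
  obtain rfl : n = 1 := by simpa using hn
  simpa [subst_id] using hfn

theorem exists_flowRel (t : ℂ) {f : NCSeries k} (hf : f [] = 0) : ∃ h, FlowRel t f h := by
  -- The inverse `n` of `1 - t h` is a solution of `n = 1 + t f(z₁ n, …, z_k n)`.
  obtain ⟨M, hM, -⟩ := existsUnique_eq_subst (⟨t • f, by
    change (t • f) [] = 0
    simp [hf]⟩ : NCSeries₀ k)
  simp only [subst_smul] at hM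
  set n : NCSeries k := 1 + M with hn
  set e := subst f fun i => X i * n with he
  have hn1 : n [] = 1 := by simp [hn, NCSeries₀.nil M]
  obtain ⟨m, hm1, hnm⟩ := exists_rightInverse n hn1
  have hmn := mul_eq_one_comm_of_nil hn1 hnm
  have he0 : e [] = 0 := by rw [he, subst_nil, hf]
  refine ⟨e * m, hf, by simp [he0], n, ?_, ?_⟩
  · have h1 : (1 - t • (e * m)) * n = n - t • e := by
      rw [sub_mul, one_mul, smul_mul_assoc, mul_assoc, hmn, mul_one]
    rw [h1, hM, hn, add_sub_cancel_right]
  · rw [mul_assoc, hmn, mul_one]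

theorem FlowRel.neg {t : ℂ} {f h : NCSeries k} (hfh : FlowRel t f h) : FlowRel (-t) h f := by
  obtain ⟨g, hg⟩ := exists_flowRel (-t) hfh.2.1
  have := hfh.trans hg
  rw [add_neg_cancel] at this
  rwa [this.eq_of_zero]

theorem FlowRel.unique {t : ℂ} {f h h' : NCSeries k} (h₁ : FlowRel t f h)
    (h₂ : FlowRel t f h') : h = h' := by
  have := h₁.neg.trans h₂
  rw [neg_add_cancel] at this
  exact this.eq_of_zero

/-- The image of `p f` at time `1` is `p` times the image of `f` at time `p`. -/
theorem FlowRel.of_smul {p : ℂ} (hp : p ≠ 0) {f h : NCSeries k}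
    (hfh : FlowRel 1 (p • f) (p • h)) : FlowRel p f h := by
  obtain ⟨hf, hh, n, hn, hfn⟩ := hfh
  refine ⟨by simpa [hp] using hf, by simpa [hp] using hh, n, by simpa using hn, ?_⟩
  rw [subst_smul, smul_mul_assoc] at hfn
  exact smul_right_injective _ hp hfn

/-- The defining equation of the flow after removal of the leading letter `a`. -/
theorem FlowRel.shift_eq {f h n : NCSeries k} (hh : h [] = 0)
    (hfn : subst f (fun i => X i * n) = h * n) (a : Fin k) :
    n * subst (shift a f) (fun i => X i * n) = shift a h * n := by
  have h1 : shift a (subst f fun i => X i * n) = n * subst (shift a f) (fun i => X i * n) := by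
    ext w
    exact subst_X_mul_cons f n a w
  rw [← h1, hfn, shift_mul, hh, zero_smul, zero_add]

/-- The defining equation of the flow after removal of the final letter `a`, where the
factor `n` cancels. -/
theorem FlowRel.rshift_eq {f h n : NCSeries k} (hf : f [] = 0) (hn : n [] = 1)
    (hfn : subst f (fun i => X i * n) = h * n) (a : Fin k) :
    subst (rshift a f) (fun i => X i * n) = rshift a h := by
  rw [subst_eq_right (X_mul_nil fun _ => n), hf, zero_smul, zero_add] at hfn
  simp only [← mul_assoc, ← Finset.sum_mul] at hfn
  have h1 := (isUnit_of_nil n hn).mul_right_cancel hfn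
  rw [← h1]
  simp [rshift_sum]

/-! ### Boxed convolution through a system of functional equations -/

/-- The system `F_u = f^{(u)}(z₁ n G₁, …, z_k n G_k) z_u n` and `G_a = ^{(a)}g(F₁, …, F_k)`, where
`f^{(u)}` and `^{(a)}g` arise from `f` and `g` by removal of a final letter `u` and of a leading
letter `a`. For `n = 1` it encodes the sums over non-crossing partitions and their Kreweras
complements: `∑ F_a G_a` is then the boxed convolution of `f` and `g`. -/
structure IsBoxSystem (n f g : NCSeries k) (F G : Fin k → NCSeries k) : Prop where
  left : ∀ u, F u = subst (rshift u f) (fun i => X i * (n * G i)) * X u * n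
  right : ∀ a, G a = subst (shift a g) F

namespace IsBoxSystem

variable {n f g : NCSeries k} {F G F' G' : Fin k → NCSeries k}

theorem left_nil (h : IsBoxSystem n f g F G) (u : Fin k) : F u [] = 0 := by
  rw [h.left]
  simp

theorem unique (h : IsBoxSystem n f g F G) (h' : IsBoxSystem n f g F' G') : F = F' ∧ G = G' := by
  have key : ∀ N a, AgreeBelow (N + 1) (F a) (F' a) ∧ AgreeBelow N (G a) (G' a) := by
    intro N
    induction N with
    | zero =>
      refine fun a => ⟨fun w hw => ?_, fun w hw => by simp at hw⟩
      rw [List.length_eq_zero_iff.mp (Nat.lt_one_iff.mp hw), h.left_nil, h'.left_nil]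
    | succ N ih =>
      have hG : ∀ a, AgreeBelow (N + 1) (G a) (G' a) := fun a => by
        rw [h.right, h'.right]
        exact AgreeBelow.subst _ h.left_nil h'.left_nil fun b => (ih b).1
      refine fun a => ⟨?_, hG a⟩
      rw [h.left, h'.left]
      refine AgreeBelow.mul (AgreeBelow.mul_X ?_ a) (AgreeBelow.refl _)
      exact AgreeBelow.subst _ (X_mul_nil fun i => n * G i) (X_mul_nil fun i => n * G' i)
        fun b => (AgreeBelow.refl _).mul ((AgreeBelow.refl _).mul (hG b))
  exact ⟨funext fun a => eq_of_agreeBelow fun N => ((key N a).1).mono (Nat.le_succ N),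
    funext fun a => eq_of_agreeBelow fun N => (key N a).2⟩

theorem exists_of (f g : NCSeries k) : ∃ F G, IsBoxSystem 1 f g F G := by
  -- The family `G` is packed into the single series `Γ = ∑ z_a G_a`.
  let F : NCSeries k → Fin k → NCSeries k := fun Γ u =>
    subst (rshift u f) (fun i => X i * (1 * shift i Γ)) * X u * 1
  have hF0 : ∀ Γ u, F Γ u [] = 0 := fun Γ u => by simp [F]
  obtain ⟨Γ, hΓ, -⟩ := existsUnique_fixed (k := k)
    (fun Γ => ∑ a, X a * subst (shift a g) (F Γ)) (by
      intro Γ Γ' w hw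
      have hF : ∀ u, AgreeBelow w.length (F Γ u) (F Γ' u) := by
        intro u
        refine AgreeBelow.mul ?_ (AgreeBelow.refl _)
        rcases Nat.eq_zero_or_pos w.length with h0 | h0
        · intro v hv
          omega
        · obtain ⟨N, hN⟩ : ∃ N, w.length = N + 1 := ⟨w.length - 1, by omega⟩
          rw [hN]
          refine AgreeBelow.mul_X (AgreeBelow.subst _ (X_mul_nil fun i => 1 * shift i Γ)
            (X_mul_nil fun i => 1 * shift i Γ') fun i => ?_) u
          refine (AgreeBelow.refl _).mul ((AgreeBelow.refl _).mul fun v hv => ?_)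
          exact hw _ (by simp; omega)
      have : AgreeBelow (w.length + 1) (∑ a, X a * subst (shift a g) (F Γ))
          (∑ a, X a * subst (shift a g) (F Γ')) :=
        AgreeBelow.sum fun a _ =>
          (AgreeBelow.subst _ (hF0 Γ) (hF0 Γ') hF).mul_succ (X_nil a)
      exact this w (Nat.lt_succ_self _))
  refine ⟨F Γ, fun a => shift a Γ, fun u => rfl, fun a => ?_⟩
  conv_lhs => rw [← hΓ]
  simp [shift_sum]

theorem sum_eq_subst_left (h : IsBoxSystem 1 f g F G) (hf : f [] = 0) :
    ∑ a, F a * G a = subst f (fun i => X i * G i) := by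
  rw [subst_eq_right (X_mul_nil G), hf, zero_smul, zero_add]
  refine Finset.sum_congr rfl fun a _ => ?_
  rw [h.left]
  simp only [one_mul, mul_one, mul_assoc]

theorem sum_eq_subst_right (h : IsBoxSystem n f g F G) (hg : g [] = 0) :
    ∑ a, F a * G a = subst g F := by
  rw [subst_eq g h.left_nil, hg, zero_smul, zero_add]
  exact Finset.sum_congr rfl fun a _ => by rw [h.right]

end IsBoxSystem

/-- The flow is compatible with boxed convolution. With `n = (1 - t h')⁻¹`, both the substitution
`z_i ↦ z_i n` in `F`, `G` and the pair `F'_u n`, `(1 - t h') G'_a n` solve the same system. -/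
theorem FlowRel.box {t : ℂ} {f g f' g' : NCSeries k} (hf : FlowRel t f f') (hg : FlowRel t g g')
    {F G F' G' : Fin k → NCSeries k} (hbox : IsBoxSystem 1 f g F G)
    (hbox' : IsBoxSystem 1 f' g' F' G') :
    FlowRel t (∑ a, F a * G a) (∑ a, F' a * G' a) := by
  obtain ⟨hf0, hf0', p, hp, hfp⟩ := hf
  obtain ⟨hg0, hg0', q, hq, hgq⟩ := hg
  set h' := ∑ a, F' a * G' a with hh'
  have hh0 : (∑ a, F a * G a) [] = 0 := by
    rw [sum_apply]
    simp [hbox.left_nil]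
  have hh0' : h' [] = 0 := by
    rw [hh', sum_apply]
    simp [hbox'.left_nil]
  have hm0 : (1 - t • h' : NCSeries k) [] = 1 := by simp [hh0']
  obtain ⟨n, hn0, hn⟩ := exists_rightInverse (1 - t • h') hm0
  have hn' := mul_eq_one_comm_of_nil hm0 hn
  have hX : ∀ a, (X a * n : NCSeries k) [] = 0 := X_mul_nil fun _ => n
  have hXG : ∀ a, (X a * G' a) [] = 0 := X_mul_nil G'
  -- Inverses are unique, so that `p(z G') = n = q(F')`.
  have hpn : subst p (fun i => X i * G' i) = n := by
    have := congrArg (fun e => subst e fun i => X i * G' i) hp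
    simp only [subst_mul hXG, subst_sub_one_smul hXG, subst_one hXG,
      ← hbox'.sum_eq_subst_left hf0'] at this
    exact (isUnit_of_nil _ hm0).mul_left_cancel (this.trans hn.symm)
  have hqn : subst q F' = n := by
    have := congrArg (fun e => subst e F') hq
    simp only [subst_mul hbox'.left_nil, subst_sub_one_smul hbox'.left_nil,
      subst_one hbox'.left_nil, ← hbox'.sum_eq_subst_right hg0'] at this
    exact (isUnit_of_nil _ hm0).mul_left_cancel (this.trans hn.symm)
  have hσ : IsBoxSystem n f g (fun u => subst (F u) fun i => X i * n)
      (fun a => subst (G a) fun i => X i * n) := by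
    refine ⟨fun u => ?_, fun a => ?_⟩
    · rw [hbox.left u, mul_one, subst_mul hX, subst_X hX, subst_subst hX _
        (X_mul_nil fun i => 1 * G i), mul_assoc]
      congr 1
      refine subst_congr fun i => ?_
      rw [subst_mul hX, subst_X hX, one_mul, mul_assoc]
    · rw [hbox.right a, subst_subst hX _ hbox.left_nil]
  have hτ : IsBoxSystem n f g (fun u => F' u * n) (fun a => (1 - t • h') * G' a * n) := by
    refine ⟨fun u => ?_, fun a => ?_⟩
    · rw [hbox'.left u, mul_one, ← FlowRel.rshift_eq hf0 (nil_of_mul_eq_one hf0' hp) hfp u,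
        subst_subst (X_mul_nil fun i => 1 * G' i) _ (X_mul_nil fun _ => p)]
      congr 2
      refine subst_congr fun i => ?_
      simp only [one_mul]
      rw [subst_mul hXG, subst_X hXG, hpn, mul_assoc, ← mul_assoc n, ← mul_assoc n, hn', one_mul]
    · have h1 := congrArg (fun e => subst e F') (FlowRel.shift_eq hg0' hgq a)
      simp only [subst_mul hbox'.left_nil, hqn, ← hbox'.right] at h1
      rw [mul_assoc, ← h1, ← mul_assoc, hn, one_mul, subst_subst hbox'.left_nil _
        (X_mul_nil fun _ => q)]
      refine subst_congr fun i => ?_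
      rw [subst_mul hbox'.left_nil, subst_X hbox'.left_nil, hqn]
  obtain ⟨hF, hG⟩ := hσ.unique hτ
  refine ⟨hh0, hh0', n, hn, ?_⟩
  rw [subst_sum, hh', Finset.sum_mul]
  refine Finset.sum_congr rfl fun a _ => ?_
  have hFa := congrFun hF a
  have hGa := congrFun hG a
  rw [subst_mul hX, hFa, hGa, mul_assoc (F' a), mul_assoc (1 - t • h'), ← mul_assoc n, hn', one_mul,
    mul_assoc]

end NCSeries

/-! ### Series with coefficients in an algebra -/

/-- Formal power series in `k` non-commuting indeterminates, which commute with the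
coefficients, over a possibly non-commutative ring `A`. -/
def OpSeries (A : Type u) (k : ℕ) : Type u := List (Fin k) → A

namespace OpSeries

variable {k : ℕ} {A : Type u}

@[ext] theorem ext {S T : OpSeries A k} (h : ∀ w, S w = T w) : S = T := funext h

section Ring

variable [Ring A]

instance : AddCommGroup (OpSeries A k) := inferInstanceAs (AddCommGroup (List (Fin k) → A))

instance : One (OpSeries A k) := ⟨fun w => if w = [] then 1 else 0⟩

/-- Multiplication: the coefficient of a word is the sum over all its splittings in two. -/
instance : Mul (OpSeries A k) :=
  ⟨fun S T w => ∑ i ∈ Finset.range (w.length + 1), S (w.take i) * T (w.drop i)⟩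

@[simp] theorem add_apply (S T : OpSeries A k) (w) : (S + T) w = S w + T w := rfl
@[simp] theorem sub_apply (S T : OpSeries A k) (w) : (S - T) w = S w - T w := rfl
@[simp] theorem zero_apply (w) : (0 : OpSeries A k) w = 0 := rfl
theorem one_apply (w) : (1 : OpSeries A k) w = if w = [] then 1 else 0 := rfl
@[simp] theorem one_nil : (1 : OpSeries A k) [] = 1 := by simp [one_apply]

theorem mul_apply (S T : OpSeries A k) (w) :
    (S * T) w = ∑ i ∈ Finset.range (w.length + 1), S (w.take i) * T (w.drop i) := rfl

@[simp] theorem mul_nil (S T : OpSeries A k) : (S * T) [] = S [] * T [] := by simp [mul_apply]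

/-- Removal of a leading letter. -/
def shift (a : Fin k) (S : OpSeries A k) : OpSeries A k := fun w => S (a :: w)

/-- Multiplication of all coefficients by an element of `A` from the left. -/
def lmul (c : A) (S : OpSeries A k) : OpSeries A k := fun w => c * S w

theorem mul_cons (S T : OpSeries A k) (a) (w) :
    (S * T) (a :: w) = S [] * T (a :: w) + (shift a S * T) w := by
  simp only [mul_apply, List.length_cons]
  rw [Finset.sum_range_succ']
  simp [add_comm, shift]

protected theorem add_mul' (S T U : OpSeries A k) : (S + T) * U = S * U + T * U := by
  ext w
  simp [mul_apply, add_mul, Finset.sum_add_distrib]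

protected theorem mul_add' (S T U : OpSeries A k) : S * (T + U) = S * T + S * U := by
  ext w
  simp [mul_apply, mul_add, Finset.sum_add_distrib]

theorem lmul_mul (c : A) (S T : OpSeries A k) : lmul c S * T = lmul c (S * T) := by
  ext w
  simp [mul_apply, lmul, Finset.mul_sum, mul_assoc]

theorem shift_mul (a : Fin k) (S T : OpSeries A k) :
    shift a (S * T) = lmul (S []) (shift a T) + shift a S * T := by
  ext w
  exact mul_cons S T a w

protected theorem mul_assoc' (S T U : OpSeries A k) : S * T * U = S * (T * U) := by
  ext w
  induction w generalizing S T U with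
  | nil => simp [mul_assoc]
  | cons a w ih =>
    rw [mul_cons, shift_mul, OpSeries.add_mul', lmul_mul, add_apply, ih, mul_cons S, mul_cons T,
      mul_nil, mul_add, mul_assoc, add_assoc]
    rfl

protected theorem one_mul' (S : OpSeries A k) : 1 * S = S := by
  ext w
  rw [mul_apply, Finset.sum_eq_single 0]
  · rw [List.take_zero, List.drop_zero, one_nil, one_mul]
  · intro i hi hi0
    have : w.take i ≠ [] := by
      rintro h
      rcases List.take_eq_nil_iff.mp h with h | rfl
      · exact hi0 h
      · simp at hi
        omega
    rw [one_apply, if_neg this, zero_mul]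
  · simp

protected theorem mul_one' (S : OpSeries A k) : S * 1 = S := by
  ext w
  rw [mul_apply, Finset.sum_eq_single w.length]
  · rw [List.take_length, List.drop_length, one_nil, mul_one]
  · intro i hi hi0
    have : w.drop i ≠ [] := by simp at hi ⊢; omega
    rw [one_apply, if_neg this, mul_zero]
  · simp

instance : Ring (OpSeries A k) :=
  { (inferInstance : AddCommGroup (OpSeries A k)) with
    mul := (· * ·)
    one := 1
    left_distrib := OpSeries.mul_add'
    right_distrib := OpSeries.add_mul'
    zero_mul := fun S => by ext w; simp [mul_apply]
    mul_zero := fun S => by ext w; simp [mul_apply]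
    mul_assoc := OpSeries.mul_assoc'
    one_mul := OpSeries.one_mul'
    mul_one := OpSeries.mul_one' }

theorem sum_apply {ι : Type*} (s : Finset ι) (S : ι → OpSeries A k) (w : List (Fin k)) :
    (∑ i ∈ s, S i) w = ∑ i ∈ s, S i w := by
  classical
  induction s using Finset.induction_on with
  | empty => simp
  | insert a s ha ih => rw [Finset.sum_insert ha, Finset.sum_insert ha, add_apply, ih]

theorem mul_apply_congr_left {S S' : OpSeries A k} (T : OpSeries A k) (w : List (Fin k))
    (h : ∀ v : List (Fin k), v.length ≤ w.length → S v = S' v) : (S * T) w = (S' * T) w :=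
  Finset.sum_congr rfl fun i _ => by rw [h _ (by simp)]

theorem mul_apply_congr_right (S : OpSeries A k) {T T' : OpSeries A k} (w : List (Fin k))
    (h : ∀ v : List (Fin k), v.length ≤ w.length → T v = T' v) : (S * T) w = (S * T') w :=
  Finset.sum_congr rfl fun i _ => by rw [h _ (by simp)]

theorem pow_apply_eq_zero {N : OpSeries A k} (hN : N [] = 0) (n : ℕ) (w : List (Fin k))
    (hw : w.length < n) : (N ^ n) w = 0 := by
  induction n generalizing w with
  | zero => simp at hw
  | succ n ih =>
    rw [pow_succ', mul_apply]
    refine Finset.sum_eq_zero fun i hi => ?_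
    rcases Nat.eq_zero_or_pos i with rfl | h0
    · simp [hN]
    · cases w with
      | nil => simp [hN]
      | cons a w => rw [ih _ (by simp at hw ⊢; omega), mul_zero]

/-- The geometric series `1 + N + N² + ⋯`, meant for `N` without constant term. -/
def geom (N : OpSeries A k) : OpSeries A k := fun w =>
  ∑ n ∈ Finset.range (w.length + 1), (N ^ n) w

theorem geom_apply_eq {N : OpSeries A k} (hN : N [] = 0) {w : List (Fin k)} {M : ℕ}
    (h : w.length < M) : geom N w = (∑ n ∈ Finset.range M, N ^ n) w := by
  rw [sum_apply]
  refine Finset.sum_subset (fun n hn => by simp at hn ⊢; omega) fun n _ hn => ?_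
  exact pow_apply_eq_zero hN n w (by simpa using hn)

theorem one_sub_mul_geom {N : OpSeries A k} (hN : N [] = 0) : (1 - N) * geom N = 1 := by
  ext w
  rw [mul_apply_congr_right _ w fun v hv => geom_apply_eq hN (Nat.lt_succ_of_le hv),
    mul_neg_geom_sum, sub_apply, pow_apply_eq_zero hN _ w (Nat.lt_succ_self _), sub_zero]

theorem geom_mul_one_sub {N : OpSeries A k} (hN : N [] = 0) : geom N * (1 - N) = 1 := by
  ext w
  rw [mul_apply_congr_left _ w fun v hv => geom_apply_eq hN (Nat.lt_succ_of_le hv),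
    geom_sum_mul_neg, sub_apply, pow_apply_eq_zero hN _ w (Nat.lt_succ_self _), sub_zero]

/-- A constant series. -/
def const (c : A) : OpSeries A k := fun w => if w = [] then c else 0

@[simp] theorem const_nil (c : A) : (const c : OpSeries A k) [] = c := if_pos rfl

theorem const_mul_apply (c : A) (S : OpSeries A k) (w : List (Fin k)) :
    ((const c : OpSeries A k) * S) w = c * S w := by
  have : (const c : OpSeries A k) = lmul c 1 := by
    ext v
    simp [const, lmul, one_apply]
  rw [this, lmul_mul, one_mul, lmul]

theorem mul_const_apply (c : A) (S : OpSeries A k) (w : List (Fin k)) :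
    (S * (const c : OpSeries A k)) w = S w * c := by
  rw [mul_apply, Finset.sum_eq_single w.length]
  · simp
  · intro i hi hi0
    have : w.drop i ≠ [] := by simp at hi ⊢; omega
    simp [const, this]
  · simp

theorem const_mul (c d : A) : (const (c * d) : OpSeries A k) = const c * const d := by
  ext w
  rw [const_mul_apply]
  simp [const]

theorem mul_apply_mem [Module ℂ A] {V V' : Submodule ℂ A} {S T : OpSeries A k}
    (hS : ∀ v, ∀ m ∈ V, S v * m ∈ V') {N : ℕ}
    (hT : ∀ w : List (Fin k), w.length < N → T w ∈ V) (w : List (Fin k)) (hw : w.length < N) :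
    (S * T) w ∈ V' :=
  Submodule.sum_mem _ fun i _ => hS _ _ (hT _ (by simp; omega))

theorem mul_apply_mem_succ [Module ℂ A] {V V' : Submodule ℂ A} {S T : OpSeries A k}
    (hS : ∀ v, ∀ m ∈ V, S v * m ∈ V') (hS0 : S [] = 0) {N : ℕ}
    (hT : ∀ w : List (Fin k), w.length < N → T w ∈ V) (w : List (Fin k))
    (hw : w.length < N + 1) : (S * T) w ∈ V' := by
  refine Submodule.sum_mem _ fun i _ => ?_
  rcases Nat.eq_zero_or_pos i with rfl | h0
  · simp [hS0]
  · cases w with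
    | nil => simp [hS0]
    | cons a w => exact hS _ _ (hT _ (by simp at hw ⊢; omega))

end Ring

variable [Ring A] [Algebra ℂ A]

/-- The inclusion of the scalar series. -/
noncomputable def ofScalar : NCSeries k →+* OpSeries A k where
  toFun f := fun w => algebraMap ℂ A (f w)
  map_one' := by
    ext w
    by_cases h : w = [] <;> simp [NCSeries.one_apply, one_apply, h]
  map_mul' f g := funext fun w => (map_sum (algebraMap ℂ A) _ _).trans
    (Finset.sum_congr rfl fun i _ => map_mul (algebraMap ℂ A) _ _)
  map_zero' := by
    ext w
    simp
  map_add' f g := funext fun w => map_add (algebraMap ℂ A) (f w) (g w)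

theorem ofScalar_apply (f : NCSeries k) (w) : (ofScalar f : OpSeries A k) w = algebraMap ℂ A (f w) :=
  rfl

theorem ofScalar_mul_const (f : NCSeries k) (c : A) :
    ofScalar f * const c = const c * ofScalar f := by
  ext w
  rw [mul_const_apply, const_mul_apply, ofScalar_apply, Algebra.commutes]

/-- Application of a linear functional to all coefficients. -/
noncomputable def mapCoeff (ψ : A →ₗ[ℂ] ℂ) : OpSeries A k →+ NCSeries k where
  toFun S := fun w => ψ (S w)
  map_zero' := by
    ext w
    simp
  map_add' S T := funext fun w => map_add ψ (S w) (T w)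

theorem mapCoeff_apply (ψ : A →ₗ[ℂ] ℂ) (S : OpSeries A k) (w) : mapCoeff ψ S w = ψ (S w) := rfl

theorem mapCoeff_ofScalar_mul (ψ : A →ₗ[ℂ] ℂ) (f : NCSeries k) (S : OpSeries A k) :
    mapCoeff ψ (ofScalar f * S) = f * mapCoeff ψ S := by
  ext w
  simp only [mapCoeff_apply, mul_apply, NCSeries.mul_apply, map_sum, ofScalar_apply]
  refine Finset.sum_congr rfl fun i _ => ?_
  rw [← Algebra.smul_def, map_smul, smul_eq_mul]

theorem mapCoeff_mul_ofScalar (ψ : A →ₗ[ℂ] ℂ) (f : NCSeries k) (S : OpSeries A k) :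
    mapCoeff ψ (S * ofScalar f) = mapCoeff ψ S * f := by
  ext w
  simp only [mapCoeff_apply, mul_apply, NCSeries.mul_apply, map_sum, ofScalar_apply]
  refine Finset.sum_congr rfl fun i _ => ?_
  rw [← Algebra.commutes, ← Algebra.smul_def, map_smul, smul_eq_mul, mul_comm]

theorem mapCoeff_ofScalar {ψ : A →ₗ[ℂ] ℂ} (hψ : ψ 1 = 1) (f : NCSeries k) :
    mapCoeff ψ (ofScalar f : OpSeries A k) = f := by
  ext w
  rw [mapCoeff_apply, ofScalar_apply, Algebra.algebraMap_eq_smul_one, map_smul, hψ, smul_eq_mul,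
    mul_one]

theorem mapCoeff_const_mul (ψ : A →ₗ[ℂ] ℂ) (c : A) (S : OpSeries A k) :
    mapCoeff ψ (const c * S) = mapCoeff (ψ ∘ₗ LinearMap.mulLeft ℂ c) S := by
  ext w
  simp [mapCoeff_apply, const_mul_apply]

theorem mapCoeff_mul_const (ψ : A →ₗ[ℂ] ℂ) (c : A) (S : OpSeries A k) :
    mapCoeff ψ (S * const c) = mapCoeff (ψ ∘ₗ LinearMap.mulRight ℂ c) S := by
  ext w
  simp [mapCoeff_apply, mul_const_apply]

/-- The series with all coefficients in a given subalgebra. -/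
def valuedIn (k : ℕ) (B : Subalgebra ℂ A) : Subring (OpSeries A k) where
  carrier := {S | ∀ w, S w ∈ B}
  mul_mem' := fun {S T} hS hT w => B.sum_mem fun i _ => B.mul_mem (hS _) (hT _)
  one_mem' := fun w => by
    rw [one_apply]
    split_ifs
    exacts [B.one_mem, B.zero_mem]
  add_mem' := fun {S T} hS hT w => B.add_mem (hS w) (hT w)
  zero_mem' := fun w => B.zero_mem
  neg_mem' := fun {S} hS w => B.neg_mem (hS w)

theorem ofScalar_mem_valuedIn (B : Subalgebra ℂ A) (f : NCSeries k) : ofScalar f ∈ valuedIn k B :=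
  fun _ => B.algebraMap_mem _

theorem const_mem_valuedIn {B : Subalgebra ℂ A} {c : A} (hc : c ∈ B) : const c ∈ valuedIn k B :=
  fun w => by
    rw [const]
    split_ifs
    exacts [hc, B.zero_mem]

theorem geom_mem_valuedIn {B : Subalgebra ℂ A} {N : OpSeries A k} (hN : N ∈ valuedIn k B) :
    geom N ∈ valuedIn k B :=
  fun w => B.sum_mem fun n _ => (valuedIn k B).pow_mem hN n w

/-- The linear pencil `∑ s_a x_a` of scalar series `s_a` and elements `x_a`. -/
noncomputable def pencil (s : Fin k → NCSeries k) (x : Fin k → A) : OpSeries A k :=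
  ∑ a, ofScalar (s a) * const (x a)

theorem pencil_nil {s : Fin k → NCSeries k} (hs : ∀ a, s a [] = 0) (x : Fin k → A) :
    pencil s x [] = 0 := by
  simp [pencil, sum_apply, ofScalar_apply, hs]

theorem pencil_mem_valuedIn {B : Subalgebra ℂ A} (s : Fin k → NCSeries k) {x : Fin k → A}
    (hx : ∀ a, x a ∈ B) : pencil s x ∈ valuedIn k B :=
  (valuedIn k B).sum_mem fun a _ =>
    (valuedIn k B).mul_mem (ofScalar_mem_valuedIn B _) (const_mem_valuedIn (hx a))

/-- The series of the values `ψ(x_{i₁} ⋯ x_{iₙ})`; for `n = 0` this is `ψ(1)`. -/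
noncomputable def valueSeries (ψ : A →ₗ[ℂ] ℂ) (x : Fin k → A) : NCSeries k :=
  fun w => ψ (w.map x).prod

theorem valueSeries_apply (ψ : A →ₗ[ℂ] ℂ) (x : Fin k → A) (w : List (Fin k)) :
    valueSeries ψ x w = ψ (w.map x).prod := rfl

/-- The resolvent of a pencil is the generating series of the words in `x₁, …, x_k`, so that a
linear functional maps it to the result of a substitution in a moment series. -/
theorem mapCoeff_geom_pencil (ψ : A →ₗ[ℂ] ℂ) {s : Fin k → NCSeries k} (hs : ∀ a, s a [] = 0)
    (x : Fin k → A) :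
    mapCoeff ψ (geom (pencil s x)) = NCSeries.subst (valueSeries ψ x) s := by
  refine NCSeries.eq_subst_of_rec (fun ψ : A →ₗ[ℂ] ℂ => mapCoeff ψ (geom (pencil s x)))
    (fun ψ => valueSeries ψ x) (fun a ψ => ψ ∘ₗ LinearMap.mulLeft ℂ (x a))
    (fun a ψ => ?_) hs (fun ψ => ?_) ψ
  · ext w
    simp [valueSeries_apply]
  · have h1 : geom (pencil s x) = 1 + pencil s x * geom (pencil s x) := by
      have := one_sub_mul_geom (pencil_nil hs x)
      rw [sub_mul, one_mul] at this
      rw [← this, sub_add_cancel]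
    have h2 : mapCoeff ψ (1 : OpSeries A k) = ψ 1 • 1 := by
      ext w
      by_cases h : w = [] <;> simp [mapCoeff_apply, one_apply, NCSeries.one_apply, h]
    conv_lhs => rw [h1]
    rw [map_add, h2, pencil, Finset.sum_mul, map_sum]
    simp only [mul_assoc, mapCoeff_ofScalar_mul, mapCoeff_const_mul, valueSeries_apply, List.map_nil,
      List.prod_nil]

end OpSeries

/-! ### Alternating products of centred elements -/

namespace FreelyIndependent

variable {A : Type u} [Ring A] [Algebra ℂ A] {φ : A →ₗ[ℂ] ℂ} {B : Bool → Subalgebra ℂ A}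

/-- The span of the products of centred elements taken alternately from the two subalgebras, with
the first factor in `B b`. -/
def altSpan (φ : A →ₗ[ℂ] ℂ) (B : Bool → Subalgebra ℂ A) (b : Bool) : Submodule ℂ A :=
  Submodule.span ℂ {m | ∃ l : List (Bool × A), (∃ c t, l = (b, c) :: t) ∧
    l.IsChain (fun p q => p.1 ≠ q.1) ∧ (∀ p ∈ l, p.2 ∈ B p.1 ∧ φ p.2 = 0) ∧
    m = (l.map Prod.snd).prod}

theorem apply_eq_zero_of_mem_altSpan (h : FreelyIndependent φ B) {b : Bool} {m : A}
    (hm : m ∈ altSpan φ B b) : φ m = 0 := by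
  induction hm using Submodule.span_induction with
  | mem m hm =>
    obtain ⟨l, ⟨c, t, rfl⟩, hl, hc, rfl⟩ := hm
    exact h _ (by simp) hl hc
  | zero => simp
  | add m m' _ _ ih ih' => simp [ih, ih']
  | smul c m _ ih => simp [ih]

theorem mem_altSpan {b : Bool} {a : A} (ha : a ∈ B b) (h0 : φ a = 0) : a ∈ altSpan φ B b :=
  Submodule.subset_span ⟨[(b, a)], ⟨a, [], rfl⟩, by simp, by simp [ha, h0], by simp⟩

theorem mul_mem_altSpan {b : Bool} {a m : A} (ha : a ∈ B b) (h0 : φ a = 0)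
    (hm : m ∈ altSpan φ B (!b) ⊔ Submodule.span ℂ {1}) : a * m ∈ altSpan φ B b := by
  obtain ⟨m, hm', e, he, rfl⟩ := Submodule.mem_sup.mp hm
  obtain ⟨c, rfl⟩ := Submodule.mem_span_singleton.mp he
  rw [mul_add, mul_smul_comm, mul_one]
  refine Submodule.add_mem _ ?_ (Submodule.smul_mem _ _ (mem_altSpan ha h0))
  clear hm he
  induction hm' using Submodule.span_induction with
  | mem m hm =>
    obtain ⟨l, ⟨c, t, rfl⟩, hl, hc, rfl⟩ := hm
    refine Submodule.subset_span ⟨(b, a) :: (!b, c) :: t, ⟨a, _, rfl⟩, ?_, ?_, by simp⟩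
    · exact List.IsChain.cons_cons (by simp) hl
    · rintro p (_ | ⟨_, hp⟩)
      exacts [⟨ha, h0⟩, hc p hp]
  | zero => simp
  | add m m' _ _ ih ih' => rw [mul_add]; exact Submodule.add_mem _ ih ih'
  | smul c m _ ih => rw [mul_smul_comm]; exact Submodule.smul_mem _ _ ih

end FreelyIndependent

/-! ### The `η`-series of the products of free families -/

open NCSeries OpSeries FreelyIndependent in
/-- Resolvent form of the multiplicativity of the `η`-series. With the resolvents
`u = (1 - h)(1 - ∑ z_a G_a x_a)⁻¹` and `v = (1 - ∑ F_a y_a)⁻¹(1 - h)` one has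
`u (1 - ∑ z_a x_a y_a) v = (1 - h) + (u - 1)(v - 1) - ∑ p_a q_a`
where `u - 1`, `v - 1`, `p_a = u z_a x_a - F_a` and `q_a = y_a v - G_a` are centred; freeness kills
all the terms of the resulting expansion of `(1 - ∑ z_a x_a y_a)⁻¹`, except `(1 - h)⁻¹`. -/
theorem FreelyIndependent.moment_series_mul {k : ℕ} {A : Type u} [Ring A] [Algebra ℂ A]
    {φ : A →ₗ[ℂ] ℂ} (hφ : φ 1 = 1) {B : Bool → Subalgebra ℂ A} (hB : FreelyIndependent φ B)
    {x y : Fin k → A} (hx : ∀ a, x a ∈ B true) (hy : ∀ a, y a ∈ B false)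
    {f g : NCSeries k} (hf0 : f [] = 0) (hg0 : g [] = 0)
    (hf : (1 - f) * valueSeries φ x = 1)
    (hg : (1 - g) * valueSeries φ y = 1)
    {F G : Fin k → NCSeries k} (hbox : IsBoxSystem 1 f g F G) :
    (1 - ∑ a, F a * G a) * valueSeries φ (fun a => x a * y a) = 1 := by
  set mx : NCSeries k := valueSeries φ x with hmx
  set my : NCSeries k := valueSeries φ y with hmy
  set mxy : NCSeries k := valueSeries φ (fun a => x a * y a) with hmxy
  set h := ∑ a, F a * G a with hh
  have hF0 := hbox.left_nil
  have hXG : ∀ a, (X a * G a) [] = 0 := X_mul_nil G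
  have hfh : subst f (fun a => X a * G a) = h := (hbox.sum_eq_subst_left hf0).symm
  have hgh : subst g F = h := (hbox.sum_eq_subst_right hg0).symm
  have hh0 : h [] = 0 := by rw [← hfh, subst_nil, hf0]
  obtain ⟨c, -, hc⟩ := exists_rightInverse (1 - h) (by simp [hh0])
  have hc' := mul_eq_one_comm_of_nil (by simp [hh0]) hc
  have hg' : my * (1 - g) = 1 := mul_eq_one_comm_of_nil (by simp [hg0]) hg
  set Nx : OpSeries A k := pencil (fun a => X a * G a) x with hNx
  set Ny : OpSeries A k := pencil F y with hNy
  set Nxy : OpSeries A k := pencil X (fun a => x a * y a) with hNxy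
  have hNx0 : Nx [] = 0 := pencil_nil hXG x
  have hNy0 : Ny [] = 0 := pencil_nil hF0 y
  have hNxy0 : Nxy [] = 0 := pencil_nil X_nil _
  set U : OpSeries A k := ofScalar (1 - h) * geom Nx with hU
  set V : OpSeries A k := geom Ny * ofScalar (1 - h) with hV
  set p : Fin k → OpSeries A k := fun a => U * (ofScalar (X a) * const (x a)) - ofScalar (F a)
    with hp
  set q : Fin k → OpSeries A k := fun a => const (y a) * V - ofScalar (G a) with hq
  have hUN : U * Nx = U - ofScalar (1 - h) := by
    have := geom_mul_one_sub hNx0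
    rw [mul_sub, mul_one, sub_eq_iff_eq_add] at this
    rw [hU, mul_assoc]
    nth_rewrite 2 [this]
    rw [mul_add, mul_one, add_sub_cancel_left]
  have hNV : Ny * V = V - ofScalar (1 - h) := by
    have := one_sub_mul_geom hNy0
    rw [sub_mul, one_mul, sub_eq_iff_eq_add] at this
    rw [hV, ← mul_assoc]
    nth_rewrite 2 [this]
    rw [add_mul, one_mul, add_sub_cancel_left]
  have hpq : ∑ a, p a * q a = U * Nxy * V - U * Nx - Ny * V + ofScalar h := by
    have h1 : U * Nxy * V =
        ∑ a, U * (ofScalar (X a) * const (x a)) * (const (y a) * V) := by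
      rw [hNxy, pencil, Finset.mul_sum, Finset.sum_mul]
      refine Finset.sum_congr rfl fun a _ => ?_
      rw [const_mul]
      simp only [mul_assoc]
    have h2 : U * Nx = ∑ a, U * (ofScalar (X a) * const (x a)) * ofScalar (G a) := by
      rw [hNx, pencil, Finset.mul_sum]
      refine Finset.sum_congr rfl fun a _ => ?_
      rw [map_mul, mul_assoc (ofScalar (X a)), ofScalar_mul_const]
      simp only [mul_assoc]
    have h3 : Ny * V = ∑ a, ofScalar (F a) * (const (y a) * V) := by
      rw [hNy, pencil, Finset.sum_mul]
      simp only [mul_assoc]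
    have h4 : (ofScalar h : OpSeries A k) = ∑ a, ofScalar (F a) * ofScalar (G a) := by
      rw [hh, map_sum]
      simp only [map_mul]
    rw [h1, h2, h3, h4, ← Finset.sum_sub_distrib, ← Finset.sum_sub_distrib,
      ← Finset.sum_add_distrib]
    refine Finset.sum_congr rfl fun a _ => ?_
    simp only [hp, hq]
    noncomm_ring
  have hkey : U * (1 - Nxy) * V = ofScalar (1 - h) + (U - 1) * (V - 1) - ∑ a, p a * q a := by
    rw [hpq, hUN, hNV, map_sub, map_one]
    noncomm_ring
  -- The four families of centred series.
  have hcU : mapCoeff φ (U - 1) = 0 := by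
    have h1 := congrArg (fun e => subst e fun a => X a * G a) hf
    simp only [subst_mul hXG, subst_sub, subst_one hXG, hfh] at h1
    rw [map_sub, hU, mapCoeff_ofScalar_mul, hNx, mapCoeff_geom_pencil φ hXG, ← hmx, h1,
      ← map_one (ofScalar (A := A)), mapCoeff_ofScalar hφ, sub_self]
  have hcV : mapCoeff φ (V - 1) = 0 := by
    have h1 := congrArg (fun e => subst e F) hg'
    simp only [subst_mul hF0, subst_sub, subst_one hF0, hgh] at h1
    rw [map_sub, hV, mapCoeff_mul_ofScalar, hNy, mapCoeff_geom_pencil φ hF0, ← hmy, h1,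
      ← map_one (ofScalar (A := A)), mapCoeff_ofScalar hφ, sub_self]
  have hcp : ∀ a, mapCoeff φ (p a) = 0 := by
    intro a
    have h0 : rshift a (1 : NCSeries k) = 0 := by ext v; simp [NCSeries.one_apply]
    have h1 : (1 - f) * rshift a mx = rshift a f := by
      have h2 := congrArg (rshift a) hf
      have h3 : rshift a (1 - f) = rshift a 1 - rshift a f := rfl
      have h4 : mx [] = 1 := by simp [hmx, valueSeries_apply, hφ]
      rw [rshift_mul, h3, h0, h4, one_smul, zero_sub, add_neg_eq_zero] at h2
      exact h2
    have h2 := congrArg (fun e => subst e fun a => X a * G a) h1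
    simp only [subst_mul hXG, subst_sub, subst_one hXG, hfh] at h2
    have h3 : valueSeries (φ ∘ₗ LinearMap.mulRight ℂ (x a)) x =
        rshift a mx := by
      ext w
      simp [hmx, valueSeries_apply]
    have h4 := hbox.left a
    simp only [one_mul, mul_one] at h4
    simp only [hp]
    rw [map_sub, mapCoeff_ofScalar hφ, ofScalar_mul_const, ← mul_assoc, mapCoeff_mul_ofScalar, hU,
      mul_assoc, mapCoeff_ofScalar_mul, mapCoeff_mul_const, hNx, mapCoeff_geom_pencil _ hXG, h3,
      h2, h4, sub_self]
  have hcq : ∀ a, mapCoeff φ (q a) = 0 := by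
    intro a
    have h0 : NCSeries.shift a (1 : NCSeries k) = 0 := by ext v; simp
    have h1 : NCSeries.shift a my * (1 - g) = NCSeries.shift a g := by
      have h2 := congrArg (NCSeries.shift a) hg'
      have h3 : NCSeries.shift a (1 - g) = NCSeries.shift a 1 - NCSeries.shift a g := rfl
      have h4 : my [] = 1 := by simp [hmy, valueSeries_apply, hφ]
      rw [NCSeries.shift_mul, h3, h0, h4, one_smul, zero_sub, neg_add_eq_zero] at h2
      exact h2.symm
    have h2 := congrArg (fun e => subst e F) h1
    simp only [subst_mul hF0, subst_sub, subst_one hF0, hgh] at h2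
    have h3 : valueSeries (φ ∘ₗ LinearMap.mulLeft ℂ (y a)) y =
        NCSeries.shift a my := by
      ext w
      simp [hmy, valueSeries_apply]
    simp only [hq]
    rw [map_sub, mapCoeff_ofScalar hφ, hV, ← mul_assoc, mapCoeff_mul_ofScalar, mapCoeff_const_mul,
      hNy, mapCoeff_geom_pencil _ hF0, h3, h2, ← hbox.right a, sub_self]
  have hU_mem : U ∈ valuedIn k (B true) := mul_mem (ofScalar_mem_valuedIn _ _)
    (geom_mem_valuedIn (pencil_mem_valuedIn _ hx))
  have hV_mem : V ∈ valuedIn k (B false) := mul_mem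
    (geom_mem_valuedIn (pencil_mem_valuedIn _ hy)) (ofScalar_mem_valuedIn _ _)
  have hp_mem : ∀ a, p a ∈ valuedIn k (B true) := fun a => sub_mem
    (mul_mem hU_mem (mul_mem (ofScalar_mem_valuedIn _ _) (const_mem_valuedIn (hx a))))
    (ofScalar_mem_valuedIn _ _)
  have hq_mem : ∀ a, q a ∈ valuedIn k (B false) := fun a => sub_mem
    (mul_mem (const_mem_valuedIn (hy a)) hV_mem) (ofScalar_mem_valuedIn _ _)
  -- Left multiplication by a centred series prepends a factor to the alternating products.
  have hmul : ∀ {b : Bool} {S : OpSeries A k}, S ∈ valuedIn k (B b) → mapCoeff φ S = 0 → ∀ v,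
      ∀ m ∈ altSpan φ B (!b) ⊔ Submodule.span ℂ {1}, S v * m ∈ altSpan φ B b :=
    fun hS h0 v m hm => mul_mem_altSpan (hS v) (congrFun h0 v) hm
  set Z : OpSeries A k := ofScalar c * (1 - Ny) * geom Nxy with hZ
  have hVZ : V * Z = geom Nxy := by
    have h1 : V * Z = geom Ny * (ofScalar (1 - h) * ofScalar c) * (1 - Ny) * geom Nxy := by
      rw [hV, hZ]
      simp only [mul_assoc]
    rw [h1, ← map_mul, hc, map_one, mul_one, geom_mul_one_sub hNy0, one_mul]
  set D : OpSeries A k := Z - ofScalar c with hD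
  have hDeq : D = ofScalar h * D + (U - 1) * (1 - (V - 1) * Z) + ∑ a, p a * (q a * Z) := by
    have h1 : U * (1 - Nxy) * V * Z = U := by
      rw [mul_assoc, hVZ, mul_assoc, one_sub_mul_geom hNxy0, mul_one]
    have h2 : (ofScalar (1 - h) : OpSeries A k) * ofScalar c = 1 := by rw [← map_mul, hc, map_one]
    have h3 : ∑ a, p a * (q a * Z) = (∑ a, p a * q a) * Z := by
      rw [Finset.sum_mul]
      simp only [mul_assoc]
    rw [hkey] at h1
    have h4 : ofScalar (1 - h) * Z = U - (U - 1) * (V - 1) * Z + (∑ a, p a * q a) * Z := by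
      nth_rewrite 1 [← h1]
      noncomm_ring
    have h5 : ofScalar (1 - h) * D = (U - 1) * (1 - (V - 1) * Z) + ∑ a, p a * (q a * Z) := by
      rw [h3, hD, mul_sub, h2, h4]
      noncomm_ring
    rw [add_assoc, ← h5, map_sub, map_one]
    noncomm_ring
  have hZ_mem : ∀ w, D w ∈ altSpan φ B true →
      Z w ∈ altSpan φ B true ⊔ Submodule.span ℂ {1} := by
    intro w hw
    have : Z w = D w + c w • 1 := by
      rw [hD, OpSeries.sub_apply, ofScalar_apply, Algebra.algebraMap_eq_smul_one, sub_add_cancel]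
    rw [this]
    exact Submodule.add_mem_sup hw (Submodule.smul_mem _ _ (Submodule.mem_span_singleton_self 1))
  have hD_mem : ∀ N, ∀ w : List (Fin k), w.length < N → D w ∈ altSpan φ B true := by
    intro N
    induction N with
    | zero => intro w hw; simp at hw
    | succ N ih =>
      intro w hw
      have hZN : ∀ w : List (Fin k), w.length < N →
          Z w ∈ altSpan φ B (!false) ⊔ Submodule.span ℂ {1} := fun w hw => hZ_mem w (ih w hw)
      rw [hDeq, OpSeries.add_apply, OpSeries.add_apply, OpSeries.sum_apply]
      refine Submodule.add_mem _ (Submodule.add_mem _ ?_ ?_) (Submodule.sum_mem _ fun a _ => ?_)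
      · refine mul_apply_mem_succ (fun v m hm => ?_) (by simp [ofScalar_apply, hh0]) ih w hw
        rw [ofScalar_apply, ← Algebra.smul_def]
        exact Submodule.smul_mem _ _ hm
      · have h0 : (U - 1) [] = 0 := by
          have : geom Nx [] = 1 := by simp [geom]
          simp [hU, this, ofScalar_apply, hh0]
        refine mul_apply_mem_succ (hmul (sub_mem hU_mem (one_mem _)) hcU) h0 (fun v hv => ?_) w hw
        rw [OpSeries.sub_apply, sub_eq_neg_add]
        refine Submodule.add_mem_sup (Submodule.neg_mem _ ?_) ?_
        · exact mul_apply_mem (hmul (sub_mem hV_mem (one_mem _)) hcV) hZN v hv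
        · rw [OpSeries.one_apply]
          split_ifs
          exacts [Submodule.mem_span_singleton_self 1, Submodule.zero_mem _]
      · have h0 : p a [] = 0 := by simp [hp, ofScalar_apply, hF0]
        refine mul_apply_mem_succ (hmul (hp_mem a) (hcp a)) h0 (fun v hv => ?_) w hw
        exact Submodule.mem_sup_left (mul_apply_mem (hmul (hq_mem a) (hcq a)) hZN v hv)
  have hφD : mapCoeff φ D = 0 := by
    ext w
    exact hB.apply_eq_zero_of_mem_altSpan (hD_mem _ w (Nat.lt_succ_self _))
  have hφVZ : mapCoeff φ ((V - 1) * Z) = 0 := by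
    ext w
    exact hB.apply_eq_zero_of_mem_altSpan (mul_apply_mem
      (hmul (sub_mem hV_mem (one_mem _)) hcV) (fun v _ => hZ_mem v (hD_mem _ v
        (Nat.lt_succ_self _))) w (Nat.lt_succ_self _))
  have hfin : mxy = c := by
    have h1 : geom Nxy = D + ofScalar c + (V - 1) * Z := by
      rw [← hVZ, hD]
      noncomm_ring
    have h2 := mapCoeff_geom_pencil φ X_nil fun a => x a * y a
    rw [← hmxy, subst_id, ← hNxy, h1, map_add, map_add, hφD, hφVZ, mapCoeff_ofScalar hφ, zero_add,
      add_zero] at h2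
    exact h2.symm
  rw [hfin, hc]

/-! ### Free realizations on a Boolean Fock space -/

namespace BooleanFock

variable {I : Type u}

/-- For Boolean cumulants `c`, the operator on the space with basis the words over `I` that maps
`e_u` to `e_{iu} + c(iu) e_∅`. -/
noncomputable def localOp (c : List I → ℂ) (i : I) : Module.End ℂ (List I →₀ ℂ) :=
  Finsupp.linearCombination ℂ fun u =>
    Finsupp.single (i :: u) 1 + c (i :: u) • Finsupp.single [] 1

/-- The free version of `localOp` on the space whose basis are the words in letters of two
colours: for the longest prefix `u` of colour `b`, the vector `e_{uv}` is mapped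
to `e_{iuv} + c_b(iu) e_v`. -/
noncomputable def op (c : Bool → List I → ℂ) (b : Bool) (i : I) :
    Module.End ℂ (List (Bool × I) →₀ ℂ) :=
  Finsupp.linearCombination ℂ fun v =>
    Finsupp.single ((b, i) :: v) 1 +
      c b (i :: (v.takeWhile fun q => q.1 = b).map Prod.snd) •
        Finsupp.single (v.dropWhile fun q => q.1 = b) 1

/-- The linear map `e_u ↦ e_{uv}`, where the letters of `u` are given the colour `b`. -/
noncomputable def embed (b : Bool) (v : List (Bool × I)) :
    (List I →₀ ℂ) →ₗ[ℂ] (List (Bool × I) →₀ ℂ) :=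
  Finsupp.lmapDomain ℂ ℂ fun u => u.map (Prod.mk b) ++ v

theorem embed_single (b : Bool) (v : List (Bool × I)) (u : List I) (r : ℂ) :
    embed b v (Finsupp.single u r) = Finsupp.single (u.map (Prod.mk b) ++ v) r := by
  simp [embed]

theorem op_comp_embed (c : Bool → List I → ℂ) (b : Bool) (i : I) {v : List (Bool × I)}
    (hv : ∀ q ∈ v.head?, q.1 ≠ b) : op c b i ∘ₗ embed b v = embed b v ∘ₗ localOp (c b) i := by
  refine Finsupp.lhom_ext' fun u => LinearMap.ext_ring ?_
  have h1 : v.takeWhile (fun q => q.1 = b) = [] := by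
    rcases v with _ | ⟨q, v⟩
    · rfl
    · simpa using hv
  have h2 : v.dropWhile (fun q => q.1 = b) = v := by
    rcases v with _ | ⟨q, v⟩
    · rfl
    · simpa using hv
  have h3 : ∀ q ∈ u.map (Prod.mk b), decide (q.1 = b) = true := by simp
  have h4 : Prod.snd ∘ Prod.mk b = (id : I → I) := rfl
  simp [embed_single, op, localOp, List.takeWhile_append_of_pos h3, List.dropWhile_append_of_pos h3,
    h1, h2, h4]

/-- An operator in the algebra generated by the operators of colour `b` acts on words only through
their prefixes of colour `b`. -/
theorem exists_localOp (c : Bool → List I → ℂ) (b : Bool)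
    {a : Module.End ℂ (List (Bool × I) →₀ ℂ)}
    (ha : a ∈ Algebra.adjoin ℂ (Set.range (op c b))) :
    ∃ a' : Module.End ℂ (List I →₀ ℂ), ∀ v : List (Bool × I), (∀ q ∈ v.head?, q.1 ≠ b) →
      a ∘ₗ embed b v = embed b v ∘ₗ a' := by
  induction ha using Algebra.adjoin_induction with
  | mem a ha =>
    obtain ⟨i, rfl⟩ := ha
    exact ⟨localOp (c b) i, fun v hv => op_comp_embed c b i hv⟩
  | algebraMap r => exact ⟨algebraMap ℂ _ r, fun v _ => by
      rw [Algebra.algebraMap_eq_smul_one, Algebra.algebraMap_eq_smul_one, LinearMap.smul_comp,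
        LinearMap.comp_smul]
      rfl⟩
  | add a d _ _ ha hd =>
    obtain ⟨a', ha'⟩ := ha
    obtain ⟨d', hd'⟩ := hd
    exact ⟨a' + d', fun v hv => by
      rw [LinearMap.add_comp, LinearMap.comp_add, ha' v hv, hd' v hv]⟩
  | mul a d _ _ ha hd =>
    obtain ⟨a', ha'⟩ := ha
    obtain ⟨d', hd'⟩ := hd
    exact ⟨a' * d', fun v hv => by
      rw [Module.End.mul_eq_comp, Module.End.mul_eq_comp, LinearMap.comp_assoc, hd' v hv,
        ← LinearMap.comp_assoc, ha' v hv, LinearMap.comp_assoc]⟩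

/-- The vacuum state. -/
noncomputable def vacuum (J : Type u) : Module.End ℂ (List J →₀ ℂ) →ₗ[ℂ] ℂ :=
  Finsupp.lapply [] ∘ₗ LinearMap.applyₗ (Finsupp.single [] 1)

theorem vacuum_apply {J : Type u} (a : Module.End ℂ (List J →₀ ℂ)) :
    vacuum J a = a (Finsupp.single [] 1) [] := rfl

theorem vacuum_one (J : Type u) : vacuum J 1 = 1 := by simp [vacuum_apply]

theorem embed_nil_apply_nil (b : Bool) (ξ : List I →₀ ℂ) : embed b [] ξ [] = ξ [] := by
  have hinj : Function.Injective fun u : List I => u.map (Prod.mk b) ++ [] := by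
    intro u u' h
    exact List.map_injective_iff.mpr (Prod.mk_right_injective b) (by simpa using h)
  exact Finsupp.mapDomain_apply hinj ξ []

/-- The vectors supported on words with first letter of colour `b`. -/
noncomputable def headed (I : Type u) (b : Bool) : Submodule ℂ (List (Bool × I) →₀ ℂ) :=
  Finsupp.supported ℂ ℂ {v | ∃ i t, v = (b, i) :: t}

theorem apply_nil_of_mem_headed {b : Bool} {ξ : List (Bool × I) →₀ ℂ} (hξ : ξ ∈ headed I b) :
    ξ [] = 0 := by
  by_contra h
  obtain ⟨i, t, h'⟩ := (Finsupp.mem_supported ℂ ξ).mp hξ (Finsupp.mem_support_iff.mpr h)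
  simp at h'

theorem apply_single_mem_headed (c : Bool → List I → ℂ) {b : Bool}
    {a : Module.End ℂ (List (Bool × I) →₀ ℂ)}
    (ha : a ∈ Algebra.adjoin ℂ (Set.range (op c b))) (h0 : vacuum _ a = 0)
    {v : List (Bool × I)} (hv : ∀ q ∈ v.head?, q.1 ≠ b) :
    a (Finsupp.single v 1) ∈ headed I b := by
  classical
  obtain ⟨a', ha'⟩ := exists_localOp c b ha
  have h1 : ∀ v : List (Bool × I), (∀ q ∈ v.head?, q.1 ≠ b) →
      a (Finsupp.single v 1) = embed b v (a' (Finsupp.single [] 1)) := fun v hv => by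
    have := LinearMap.congr_fun (ha' v hv) (Finsupp.single [] 1)
    simpa [embed_single] using this
  have h2 : a' (Finsupp.single [] 1) [] = 0 := by
    rw [← embed_nil_apply_nil b, ← h1 [] (by simp), ← vacuum_apply, h0]
  rw [h1 v hv]
  refine (Finsupp.mem_supported ℂ _).mpr fun w hw => ?_
  obtain ⟨u, hu, rfl⟩ := Finset.mem_image.mp (Finsupp.mapDomain_support hw)
  rcases u with _ | ⟨i, u⟩
  · exact absurd h2 (Finsupp.mem_support_iff.mp hu)
  · exact ⟨i, u.map (Prod.mk b) ++ v, by simp⟩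

theorem freelyIndependent_op (c : Bool → List I → ℂ) :
    FreelyIndependent (vacuum (Bool × I)) fun b => Algebra.adjoin ℂ (Set.range (op c b)) := by
  have key : ∀ (l : List (Bool × Module.End ℂ (List (Bool × I) →₀ ℂ))) (b) (a),
      ((b, a) :: l).IsChain (fun p q => p.1 ≠ q.1) →
      (∀ p ∈ (b, a) :: l, p.2 ∈ Algebra.adjoin ℂ (Set.range (op c p.1)) ∧ vacuum _ p.2 = 0) →
      (((b, a) :: l).map Prod.snd).prod (Finsupp.single [] 1) ∈ headed I b := by
    intro l
    induction l with
    | nil =>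
      intro b a _ h
      obtain ⟨h1, h2⟩ := h (b, a) (by simp)
      simpa using apply_single_mem_headed c h1 h2 (v := []) (by simp)
    | cons p l ih =>
      intro b a hl h
      obtain ⟨b', a'⟩ := p
      obtain ⟨h1, h2⟩ := h (b, a) (by simp)
      rw [List.isChain_cons_cons] at hl
      have hm := ih b' a' hl.2 fun p hp => h p (List.mem_cons_of_mem _ hp)
      rw [List.map_cons, List.prod_cons, Module.End.mul_apply]
      generalize (((b', a') :: l).map Prod.snd).prod (Finsupp.single [] 1) = ξ at hm
      have hle : headed I b' ≤ (headed I b).comap a := by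
        rw [headed, Finsupp.supported_eq_span_single, Submodule.span_le]
        rintro _ ⟨v, ⟨i, t, rfl⟩, rfl⟩
        exact apply_single_mem_headed c h1 h2 (by simpa using hl.1.symm)
      exact hle hm
  intro l hl hc h
  rcases l with _ | ⟨⟨b, a⟩, l⟩
  · exact absurd rfl hl
  · rw [vacuum_apply]
    exact apply_nil_of_mem_headed (key l b a hc h)

open NCSeries in
/-- The action of a word of operators on the vacuum vector, in terms of the moments `m`. -/
theorem prod_localOp_apply {k : ℕ} {f m : NCSeries k} (hm0 : m [] = 1) (hf0 : f [] = 0)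
    (hm : (1 - f) * m = 1) (w : List (Fin k)) :
    (w.map fun a => localOp (fun l => f (l.map ULift.down)) (ULift.up.{u} a)).prod
      (Finsupp.single [] 1) =
    ∑ i ∈ Finset.range (w.length + 1),
      m (w.drop i) • Finsupp.single ((w.take i).map ULift.up) 1 := by
  induction w with
  | nil => simp [hm0]
  | cons a w ih =>
    have h1 : m (a :: w) = (NCSeries.shift a f * m) w := by
      have h2 := congrFun hm (a :: w)
      rw [sub_mul, one_mul] at h2
      change m (a :: w) - (f * m) (a :: w) = (1 : NCSeries k) (a :: w) at h2
      rw [mul_cons, hf0, NCSeries.one_cons] at h2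
      linear_combination h2
    rw [List.map_cons, List.prod_cons, Module.End.mul_apply, ih, map_sum, List.length_cons,
      Finset.sum_range_succ' _ (w.length + 1), List.drop_zero, h1, NCSeries.mul_apply, Finset.sum_smul,
      List.take_zero, List.map_nil, ← Finset.sum_add_distrib]
    refine Finset.sum_congr rfl fun i _ => ?_
    rw [map_smul, localOp, Finsupp.linearCombination_single, one_smul, smul_add, smul_smul,
      List.drop_succ_cons, List.take_succ_cons, List.map_cons, shift_apply, List.map_cons,
      List.map_map, mul_comm]
    simp [Function.comp_def]

open NCSeries in
/-- The operators `op c b` have the prescribed moments in the vacuum state. -/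
theorem vacuum_prod_op {k : ℕ} {f m : Bool → NCSeries k} (hm0 : ∀ b, m b [] = 1)
    (hf0 : ∀ b, f b [] = 0) (hm : ∀ b, (1 - f b) * m b = 1) (b : Bool) (w : List (Fin k)) :
    vacuum _ (w.map fun a => op (fun b l => f b (l.map ULift.down)) b (ULift.up.{u} a)).prod =
      m b w := by
  have h1 : ∀ w : List (Fin k),
      (w.map fun a => op (fun b l => f b (l.map ULift.down)) b (ULift.up.{u} a)).prod ∘ₗ
        embed b [] = embed b [] ∘ₗ
      (w.map fun a => localOp (fun l => f b (l.map ULift.down)) (ULift.up.{u} a)).prod := by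
    intro w
    induction w with
    | nil => rfl
    | cons a w ih =>
      rw [List.map_cons, List.prod_cons, Module.End.mul_eq_comp, LinearMap.comp_assoc, ih,
        ← LinearMap.comp_assoc, op_comp_embed _ _ _ (by simp), LinearMap.comp_assoc, List.map_cons,
        List.prod_cons, Module.End.mul_eq_comp]
  have h2 := LinearMap.congr_fun (h1 w) (Finsupp.single [] 1)
  rw [LinearMap.comp_apply, LinearMap.comp_apply, embed_single, List.map_nil, List.append_nil] at h2
  rw [vacuum_apply, h2, embed_nil_apply_nil, prod_localOp_apply (hm0 b) (hf0 b) (hm b),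
    Finsupp.finsetSum_apply, Finset.sum_eq_single 0]
  · simp
  · intro i hi hi0
    rcases w with _ | ⟨a, w⟩
    · simp at hi
      omega
    · obtain ⟨j, rfl⟩ := Nat.exists_eq_succ_of_ne_zero hi0
      simp
  · simp

end BooleanFock

/-! ### The transformations `𝔹_t` and free multiplicative convolution -/

namespace Dalg

open NCSeries

variable {k : ℕ}

theorem one_sub_eta_mul (μ : Dalg k) :
    (1 - etaSeries μ : NCSeries k) * (1 + momentSeries μ) = 1 := by
  have hu := isUnit_of_nil _ (one_add_nil (momentSeries μ))
  rw [sub_mul, etaSeries, mul_assoc, Ring.inverse_mul_cancel _ hu]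
  simp

theorem etaSeries_eq_of_mul_eq_one {μ : Dalg k} {h : NCSeries k}
    (hh : (1 - h) * (1 + momentSeries μ) = 1) : (etaSeries μ : NCSeries k) = h :=
  sub_right_injective ((isUnit_of_nil _ (one_add_nil (momentSeries μ))).mul_right_cancel
    ((one_sub_eta_mul μ).trans hh.symm))

theorem momentSeries_apply (μ : Dalg k) (w : List (Fin k)) :
    (momentSeries μ : NCSeries k) w =
      if w = [] then 0 else μ.1 (w.map (FreeAlgebra.ι ℂ)).prod := rfl

theorem one_add_momentSeries_jointDist {A : Type u} [Ring A] [Algebra ℂ A] (φ : A →ₗ[ℂ] ℂ)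
    (hφ : φ 1 = 1) (x : Fin k → A) :
    (1 + momentSeries (jointDist φ hφ x) : NCSeries k) = OpSeries.valueSeries φ x := by
  ext w
  rw [add_apply, momentSeries_apply, one_apply, OpSeries.valueSeries_apply]
  by_cases hw : w = []
  · simp [hw, hφ]
  · simp [hw, jointDist, map_list_prod, Function.comp_def]

theorem flowRel_rTransform_etaSeries (μ : Dalg k) :
    FlowRel 1 (rTransform μ : NCSeries k) (etaSeries μ) := by
  refine ⟨NCSeries₀.nil _, NCSeries₀.nil _, 1 + momentSeries μ, ?_, ?_⟩
  · rw [one_smul, one_sub_eta_mul]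
  · have := one_sub_eta_mul μ
    rw [sub_mul, one_mul, sub_eq_iff_eq_add] at this
    rw [rTransform_spec]
    exact add_left_cancel this

theorem rTransform_boxplusPow (μ : Dalg k) (t : ℝ) :
    rTransform (μ.boxplusPow t) = (t : ℂ) • rTransform μ :=
  (rEquiv k).apply_symm_apply _

theorem etaSeries_uplusPow (μ : Dalg k) (t : ℝ) :
    etaSeries (μ.uplusPow t) = (t : ℂ) • etaSeries μ :=
  (etaEquiv k).apply_symm_apply _

/-- The transformation `𝔹_t` is the time `t` map of the flow on `η`-series. -/
theorem flowRel_etaSeries_BB {t : ℝ} (ht : 0 ≤ t) (μ : Dalg k) :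
    FlowRel t (etaSeries μ : NCSeries k) (etaSeries (BB t μ)) := by
  have hp : ((1 + t : ℝ) : ℂ) ≠ 0 := by
    rw [Complex.ofReal_ne_zero]
    positivity
  have h1 := flowRel_rTransform_etaSeries (μ.boxplusPow (1 + t))
  have h2 : etaSeries (μ.boxplusPow (1 + t)) = ((1 + t : ℝ) : ℂ) • etaSeries (BB t μ) := by
    rw [BB, etaSeries_uplusPow, smul_smul, one_div, Complex.ofReal_inv, mul_inv_cancel₀ hp,
      one_smul]
  rw [rTransform_boxplusPow, h2, Submodule.coe_smul, Submodule.coe_smul] at h1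
  have h3 := (flowRel_rTransform_etaSeries μ).neg.trans (h1.of_smul hp)
  simpa using h3

theorem eq_of_coe_etaSeries_eq {μ ν : Dalg k} (h : (etaSeries μ : NCSeries k) = etaSeries ν) :
    μ = ν := etaSeries_bijective.1 (Subtype.ext h)

theorem BB_bijective {t : ℝ} (ht : 0 ≤ t) : Function.Bijective (BB t : Dalg k → Dalg k) := by
  refine ⟨fun μ ν h => ?_, fun ν => ?_⟩
  · have h1 := (flowRel_etaSeries_BB ht μ).neg
    rw [h] at h1
    exact eq_of_coe_etaSeries_eq (h1.unique (flowRel_etaSeries_BB ht ν).neg)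
  · obtain ⟨f, hf⟩ := exists_flowRel (-(t : ℂ)) (NCSeries₀.nil (etaSeries ν))
    obtain ⟨μ, hμ⟩ := etaSeries_bijective.2 ⟨f, hf.2.1⟩
    have hf' := hf.neg
    rw [neg_neg] at hf'
    have h1 := flowRel_etaSeries_BB ht μ
    rw [hμ] at h1
    exact ⟨μ, eq_of_coe_etaSeries_eq (h1.unique hf')⟩

theorem BB_comp {s t : ℝ} (hs : 0 ≤ s) (ht : 0 ≤ t) :
    (BB s ∘ BB t : Dalg k → Dalg k) = BB (s + t) := by
  funext μ
  have h1 := (flowRel_etaSeries_BB ht μ).trans (flowRel_etaSeries_BB hs (BB t μ))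
  have h2 := flowRel_etaSeries_BB (add_nonneg hs ht) μ
  rw [add_comm s t, Complex.ofReal_add] at h2
  rw [add_comm s t]
  exact eq_of_coe_etaSeries_eq (h1.unique h2)

theorem eq_booleanBercoviciPata_iff (F : Dalg k → Dalg k) :
    F = booleanBercoviciPata ↔ ∀ μ, (F μ).rTransform = μ.etaSeries := by
  rw [funext_iff]
  exact forall_congr' fun μ => ((rEquiv k).eq_symm_apply)

theorem BB_one : (BB 1 : Dalg k → Dalg k) = booleanBercoviciPata := by
  rw [eq_booleanBercoviciPata_iff]
  intro μ
  have h1 := flowRel_etaSeries_BB zero_le_one μ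
  rw [Complex.ofReal_one] at h1
  exact Subtype.ext ((flowRel_rTransform_etaSeries (BB 1 μ)).neg.unique h1.neg)

/-- The `η`-series of a free multiplicative convolution is the boxed convolution of the
`η`-series of the factors. -/
theorem etaSeries_of_isFreeMulConv {μ ν ρ : Dalg k} (h : IsFreeMulConv.{u} μ ν ρ)
    {F G : Fin k → NCSeries k} (hbox : IsBoxSystem 1 (etaSeries μ : NCSeries k) (etaSeries ν) F G) :
    (etaSeries ρ : NCSeries k) = ∑ a, F a * G a := by
  obtain ⟨A, _, _, φ, hφ, x, y, rfl, rfl, hfree, rfl⟩ := h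
  refine etaSeries_eq_of_mul_eq_one ?_
  rw [one_add_momentSeries_jointDist]
  refine hfree.moment_series_mul hφ (fun a => ?_) (fun a => ?_) (NCSeries₀.nil _) (NCSeries₀.nil _)
    ?_ ?_ hbox
  · simpa using Algebra.subset_adjoin (Set.mem_range_self a)
  · simpa using Algebra.subset_adjoin (Set.mem_range_self a)
  · rw [← one_add_momentSeries_jointDist φ hφ, one_sub_eta_mul]
  · rw [← one_add_momentSeries_jointDist φ hφ, one_sub_eta_mul]

theorem exists_isFreeMulConv (μ ν : Dalg k) : ∃ ρ, IsFreeMulConv.{u} μ ν ρ := by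
  let d : Bool → Dalg k := fun b => if b then μ else ν
  let c : Bool → List (ULift.{u} (Fin k)) → ℂ :=
    fun b l => (etaSeries (d b) : NCSeries k) (l.map ULift.down)
  let x : Bool → Fin k → Module.End ℂ (List (Bool × ULift.{u} (Fin k)) →₀ ℂ) :=
    fun b a => BooleanFock.op c b (ULift.up a)
  have hx : ∀ b, jointDist (BooleanFock.vacuum _) (BooleanFock.vacuum_one _) (x b) = d b := by
    intro b
    refine momentSeries_bijective.1 (Subtype.ext (add_left_cancel (a := (1 : NCSeries k)) ?_))
    rw [one_add_momentSeries_jointDist]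
    ext w
    exact BooleanFock.vacuum_prod_op (f := fun b => (etaSeries (d b) : NCSeries k))
      (m := fun b => (1 + momentSeries (d b) : NCSeries k)) (fun b => one_add_nil _)
      (fun b => NCSeries₀.nil _) (fun b => one_sub_eta_mul (d b)) b w
  have hr : ∀ b, Set.range (x b) = Set.range (BooleanFock.op c b) := fun b =>
    ULift.up_surjective.range_comp (BooleanFock.op c b)
  refine ⟨_, _, inferInstance, inferInstance, BooleanFock.vacuum _, BooleanFock.vacuum_one _,
    x true, x false, hx true, hx false, ?_, rfl⟩
  have hB : (fun b : Bool => if b then Algebra.adjoin ℂ (Set.range (x true))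
      else Algebra.adjoin ℂ (Set.range (x false))) =
      fun b => Algebra.adjoin ℂ (Set.range (BooleanFock.op c b)) := by
    funext b
    rw [← hr b]
    cases b <;> rfl
  rw [hB]
  exact BooleanFock.freelyIndependent_op c

theorem isFreeMulConv_iff (μ ν ρ : Dalg k) :
    IsFreeMulConv.{u} μ ν ρ ↔ ρ = freeMulConv μ ν := by
  have h0 : IsFreeMulConv.{0} μ ν (freeMulConv μ ν) := by
    rw [freeMulConv, dif_pos (exists_isFreeMulConv μ ν)]
    exact (exists_isFreeMulConv μ ν).choose_spec
  obtain ⟨F, G, hbox⟩ := IsBoxSystem.exists_of (etaSeries μ : NCSeries k) (etaSeries ν)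
  have hu : ∀ ρ, IsFreeMulConv.{u} μ ν ρ → ρ = freeMulConv μ ν := fun ρ h =>
    eq_of_coe_etaSeries_eq ((etaSeries_of_isFreeMulConv h hbox).trans
      (etaSeries_of_isFreeMulConv h0 hbox).symm)
  refine ⟨hu ρ, ?_⟩
  rintro rfl
  obtain ⟨ρ, hρ⟩ := exists_isFreeMulConv.{u} μ ν
  rwa [← hu ρ hρ]

theorem BB_freeMulConv {t : ℝ} (ht : 0 ≤ t) (μ ν : Dalg k) :
    BB t (freeMulConv μ ν) = freeMulConv (BB t μ) (BB t ν) := by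
  obtain ⟨F, G, hbox⟩ := IsBoxSystem.exists_of (etaSeries μ : NCSeries k) (etaSeries ν)
  obtain ⟨F', G', hbox'⟩ :=
    IsBoxSystem.exists_of (etaSeries (BB t μ) : NCSeries k) (etaSeries (BB t ν))
  have h1 := (flowRel_etaSeries_BB ht μ).box (flowRel_etaSeries_BB ht ν) hbox hbox'
  rw [← etaSeries_of_isFreeMulConv ((isFreeMulConv_iff.{0} _ _ _).mpr rfl) hbox,
    ← etaSeries_of_isFreeMulConv ((isFreeMulConv_iff.{0} _ _ _).mpr rfl) hbox'] at h1
  exact eq_of_coe_etaSeries_eq ((flowRel_etaSeries_BB ht _).unique h1)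

end Dalg

/-- The first conjunct says that `⊠` is well defined: any two distributions have free realizations,
and the joint distribution of the products is `freeMulConv μ ν` for all of them. -/
theorem theorem4p11 (k : ℕ) :
    (∀ μ ν ρ : Dalg k, IsFreeMulConv.{u} μ ν ρ ↔ ρ = freeMulConv μ ν) ∧
    (∀ t : ℝ, 0 ≤ t → Function.Bijective (Dalg.BB t : Dalg k → Dalg k)) ∧
    (∀ s t : ℝ, 0 ≤ s → 0 ≤ t →
      (Dalg.BB s ∘ Dalg.BB t : Dalg k → Dalg k) = Dalg.BB (s + t)) ∧
    ((Dalg.BB 1 : Dalg k → Dalg k) = Dalg.booleanBercoviciPata ∧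
      ∀ F : Dalg k → Dalg k,
        F = Dalg.booleanBercoviciPata ↔ ∀ μ, (F μ).rTransform = μ.etaSeries) ∧
    (∀ t : ℝ, 0 ≤ t → ∀ μ ν : Dalg k,
      Dalg.BB t (freeMulConv μ ν) = freeMulConv (Dalg.BB t μ) (Dalg.BB t ν)) :=
  ⟨Dalg.isFreeMulConv_iff, fun _ ht => Dalg.BB_bijective ht, fun _ _ hs ht => Dalg.BB_comp hs ht,
    ⟨Dalg.BB_one, Dalg.eq_booleanBercoviciPata_iff⟩, fun _ ht => Dalg.BB_freeMulConv ht⟩
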